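/- Let $\mathbb{H}^n$ be the Heisenberg group: $\mathbb{R}^{2n+1}$ with points $\xi=(z,t)=(x,y,t)$, group law $\xi\circ\xi'=(x+x',\,y+y',\,t+t'+2\langle y,x'\rangle-2\langle x,y'\rangle)$, dilations $\Phi_\lambda(z,t)=(\lambda z,\lambda^2 t)$ for $\lambda>0$, Lebesgue measure, homogeneous dimension $Q=2n+2$ and standard norm $|\xi|_{\mathbb{H}^n}=(|z|^4+t^2)^{1/4}$. Let $s\in(0,1)$, $p\in(1,\infty)$, and let $d_{\mathrm o}:\mathbb{H}^n\to[0,\infty)$ be a homogeneous norm, i.e. a continuous function with $d_{\mathrm o}(\Phi_\lambda(\xi))=\lambda\, d_{\mathrm o}(\xi)$ for all $\lambda>0$ and $\xi\in\mathbb{H}^n$, and $d_{\mathrm o}(\xi)=0$ if and only if $\xi=0$. For an open set $U\subseteq\mathbb{H}^n$ let $$W^{s,p}(U)=\Big\{u\in L^p(U):\ \frac{|u(\xi)-u(\eta)|}{|\eta^{-1}\circ\xi|_{\mathbb{H}^n}^{Q/p+s}}\in L^p(U\times U)\Big\}.$$ Let $\Omega,\Omega'\subset\mathbb{H}^n$ be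 bounded open sets with $\overline\Omega\subset\Omega'$, let $h:\mathbb{H}^n\to[-\infty,\infty)$ and $g\in W^{s,p}(\mathbb{H}^n)$, and put $$\mathcal{K}_{g,h}(\Omega,\Omega')=\{u\in W^{s,p}(\Omega'):\ u\ge h\text{ a.e. in }\Omega,\ u=g\text{ a.e. in }\mathbb{H}^n\setminus\Omega\},$$ a set of real functions on $\mathbb{H}^n$, identified when they agree almost everywhere. Let $f:\mathbb{H}^n\times\mathbb{R}\to\mathbb{R}$ satisfy: (i) $f(\cdot,x)$ is measurable for every $x\in\mathbb{R}$, and $f(\xi,\cdot)$ is continuous for a.e. $\xi\in\mathbb{H}^n$; (ii) $f(\cdot,x)\in L^\infty_{\rm loc}(\mathbb{H}^n)$ for every $x\in\mathbb{R}$, and the bound on $\Omega$ is uniform in $x$: $\sup_{x\in\mathbb{R}}\|f(\cdot,x)\|_{L^\infty(\Omega)}<\infty$; (iii) $(f(\xi,x_1)-f(\xi,x_2))(x_1-x_2)\le 0$ for all $x_1,x_2\in\mathbb{R}$ and a.e. $\xi\in\mathbb{H}^n$. Define $$\langle\mathbf{A}(u),v\rangle=\int_{\mathbb{H}^n}\int_{\mathbb{H}^n}\frac{|u(\xi)-u(\eta)|^{p-2}(u(\xi)-u(\eta))(v(\xi)-v(\eta))}{d_{\mathrm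 o}(\eta^{-1}\circ\xi)^{Q+sp}}\,d\xi\,d\eta-\int_\Omega f(\xi,u(\xi))\,v(\xi)\,d\xi .$$ If $\mathcal{K}_{g,h}(\Omega,\Omega')\ne\emptyset$, then the integrals in $\langle\mathbf{A}(u),v-u\rangle$ converge absolutely for all $u,v\in\mathcal{K}_{g,h}(\Omega,\Omega')$, and there is exactly one $u\in\mathcal{K}_{g,h}(\Omega,\Omega')$ (up to equality almost everywhere) such that $$\langle\mathbf{A}(u),v-u\rangle\ge 0\qquad\text{for all }v\in\mathcal{K}_{g,h}(\Omega,\Omega').$$ -/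

import Mathlib

open MeasureTheory

noncomputable section

/-- Points `ξ = (x, y, t)` of the Heisenberg group `ℍⁿ`, i.e. `ℝ²ⁿ⁺¹` with its usual topology and
Lebesgue measure. The group law is `Heis.mul` (with neutral element `0`), not the componentwise
product. -/
abbrev Heis (n : ℕ) : Type := (Fin n → ℝ) × (Fin n → ℝ) × ℝ

namespace Heis

variable {n : ℕ}

/-- `ξ ∘ ξ' = (x + x', y + y', t + t' + 2⟨y, x'⟩ - 2⟨x, y'⟩)`. -/
def mul (ξ ξ' : Heis n) : Heis n :=
  (ξ.1 + ξ'.1, ξ.2.1 + ξ'.2.1,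
    ξ.2.2 + ξ'.2.2 + 2 * (∑ i, ξ.2.1 i * ξ'.1 i) - 2 * (∑ i, ξ.1 i * ξ'.2.1 i))

/-- The inverse for the group law `Heis.mul`. -/
def inv (ξ : Heis n) : Heis n := (-ξ.1, -ξ.2.1, -ξ.2.2)

theorem mul_assoc (ξ η ζ : Heis n) : mul (mul ξ η) ζ = mul ξ (mul η ζ) := by
  refine Prod.ext ?_ (Prod.ext ?_ ?_)
  · simp [mul, add_assoc]
  · simp [mul, add_assoc]
  · simp only [mul, Pi.add_apply, add_mul, mul_add, Finset.sum_add_distrib]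
    ring

theorem inv_mul_self (ξ : Heis n) : mul (inv ξ) ξ = 0 := by
  refine Prod.ext ?_ (Prod.ext ?_ ?_)
  · simp [mul, inv]
  · simp [mul, inv]
  · simp [mul, inv, mul_comm]

/-- The dilations `Φ_r(z, t) = (r z, r² t)`. -/
def dil (r : ℝ) (ξ : Heis n) : Heis n := (r • ξ.1, r • ξ.2.1, r ^ 2 * ξ.2.2)

/-- The homogeneous dimension `Q = 2n + 2`, as a real number. -/
def homDim (n : ℕ) : ℝ := 2 * n + 2

/-- The standard homogeneous norm `(|z|⁴ + t²)^(1/4)`, where `|z|² = |x|² + |y|²`. -/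
def stdNorm (ξ : Heis n) : ℝ :=
  (((∑ i, ξ.1 i ^ 2) + ∑ i, ξ.2.1 i ^ 2) ^ 2 + ξ.2.2 ^ 2) ^ (1 / 4 : ℝ)

/-- Homogeneous norms on `ℍⁿ` (neither symmetry nor a triangle inequality is required). -/
structure IsHomogeneousNorm (d : Heis n → ℝ) : Prop where
  continuous : Continuous d
  nonneg : ∀ ξ, 0 ≤ d ξ
  map_dil : ∀ r : ℝ, 0 < r → ∀ ξ, d (dil r ξ) = r * d ξ
  eq_zero_iff : ∀ ξ, d ξ = 0 ↔ ξ = 0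

/-- `u ∈ W^{s,p}(U)`: `u ∈ L^p(U)` and
`|u(ξ) - u(η)| / |η⁻¹ ∘ ξ|^{Q/p + s} ∈ L^p(U × U)`. -/
def MemWsp (s p : ℝ) (U : Set (Heis n)) (u : Heis n → ℝ) : Prop :=
  MemLp u (ENNReal.ofReal p) (volume.restrict U) ∧
  MemLp (fun z : Heis n × Heis n =>
      |u z.1 - u z.2| / stdNorm (mul (inv z.2) z.1) ^ (homDim n / p + s))
    (ENNReal.ofReal p) ((volume.restrict U).prod (volume.restrict U))

/-- The admissible class `K_{g,h}(Ω, Ω')`; its elements are functions on all of `ℍⁿ`, to be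
identified when they agree almost everywhere. -/
def obstacleClass (s p : ℝ) (g : Heis n → ℝ) (h : Heis n → EReal) (Ω Ω' : Set (Heis n)) :
    Set (Heis n → ℝ) :=
  {u | MemWsp s p Ω' u ∧ (∀ᵐ ξ ∂(volume.restrict Ω), h ξ ≤ (u ξ : EReal)) ∧
    (∀ᵐ ξ ∂(volume.restrict Ωᶜ), u ξ = g ξ)}

/-- `|u(ξ)-u(η)|^{p-2} (u(ξ)-u(η)) (v(ξ)-v(η)) / d(η⁻¹ ∘ ξ)^{Q+sp}` at `z = (ξ, η)`. -/
def formIntegrand (d : Heis n → ℝ) (s p : ℝ) (u v : Heis n → ℝ) (z : Heis n × Heis n) : ℝ :=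
  |u z.1 - u z.2| ^ (p - 2) * (u z.1 - u z.2) * (v z.1 - v z.2) /
    d (mul (inv z.2) z.1) ^ (homDim n + s * p)

/-- The pairing `⟨A(u), v⟩`. -/
def pairing (d : Heis n → ℝ) (s p : ℝ) (f : Heis n → ℝ → ℝ) (Ω : Set (Heis n))
    (u v : Heis n → ℝ) : ℝ :=
  (∫ z : Heis n × Heis n, formIntegrand d s p u v z) - ∫ ξ in Ω, f ξ (u ξ) * v ξ

/-- `u` solves the obstacle problem in `K_{g,h}(Ω, Ω')`. -/
def IsObstacleSolution (d : Heis n → ℝ) (s p : ℝ) (f : Heis n → ℝ → ℝ) (g : Heis n → ℝ)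
    (h : Heis n → EReal) (Ω Ω' : Set (Heis n)) (u : Heis n → ℝ) : Prop :=
  u ∈ obstacleClass s p g h Ω Ω' ∧
    ∀ v ∈ obstacleClass s p g h Ω Ω', 0 ≤ pairing d s p f Ω u (v - u)

/-- `f(·, x)` is (Lebesgue) measurable for all `x`, and `f(ξ, ·)` is continuous for a.e. `ξ`. -/
def IsCaratheodory (f : Heis n → ℝ → ℝ) : Prop :=
  (∀ x, AEMeasurable (fun ξ => f ξ x) volume) ∧ ∀ᵐ ξ, Continuous (f ξ)

/-- `f(·, x) ∈ L^∞_loc(ℍⁿ)` for every `x`, with a bound on `Ω` that is uniform in `x`. -/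
def IsLocBoundedUnif (f : Heis n → ℝ → ℝ) (Ω : Set (Heis n)) : Prop :=
  (∀ x, ∀ K : Set (Heis n), IsCompact K →
    ∃ C : ℝ, ∀ᵐ ξ ∂(volume.restrict K), |f ξ x| ≤ C) ∧
  ∃ M : ℝ, ∀ x, ∀ᵐ ξ ∂(volume.restrict Ω), |f ξ x| ≤ M

/-- `(f(ξ, x₁) - f(ξ, x₂)) (x₁ - x₂) ≤ 0` for all `x₁, x₂` and a.e. `ξ`. -/
def IsNonincreasing (f : Heis n → ℝ → ℝ) : Prop :=
  ∀ x₁ x₂ : ℝ, ∀ᵐ ξ, (f ξ x₁ - f ξ x₂) * (x₁ - x₂) ≤ 0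

end Heis

end

noncomputable section

namespace Heis

/-! ### Inequalities for the power function `|x| ^ p` -/

/-! The kernel times `dξ dη` is treated as a measure `μ` on pairs. The pairing is then the first
variation of `J(u) = p⁻¹ ∫ |u(ξ) - u(η)|^p dμ - ∫_Ω F(ξ, u)`, where `F` is the primitive of `f` in
the second variable. `F` is concave because `f` is nonincreasing, so `J` is convex, and the solution
is found as its minimiser.

Existence is the direct method without weak compactness. A Poincaré inequality and the boundedness
of `f` make `J` coercive (`exists_le_energy`). A quantitative uniform convexity of `|x|^p`
(`exists_abs_sub_rpow_le_midDefect`) makes minimising sequences Cauchy in the energy seminorm, hence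
in `L^p` by Poincaré, and Fatou's lemma passes to the limit (`exists_energy_minimizer`). Convexity
of the class turns minimality into the variational inequality (`weakForm_nonneg_of_minimizer`).
Uniqueness comes from strict monotonicity of `|a|^(p-2) a`, monotonicity of `f` and Poincaré
(`ae_eq_of_weakForm_nonneg`).

Three facts bring the Heisenberg problem into this frame. An admissible `u` has finite energy on the
whole group, since `u - g` vanishes off `Ω`, points of `Ω` stay at positive distance from the
complement of `Ω'`, and the kernel is integrable away from the origin
(`obstacleClass_eq_energyClass`). Poincaré follows by comparing a function with its zero values on a
ball disjoint from `Ω` (`isInteraction_kernelMeasure`). Finally `f` is altered on a null set so that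
its properties hold everywhere (`exists_isBoundedForcing`). -/

theorem _root_.StrictConvexOn.tangent_lt {φ : ℝ → ℝ} (hφ : StrictConvexOn ℝ Set.univ φ)
    {a b φ' : ℝ} (hd : HasDerivAt φ φ' b) (hab : a ≠ b) : φ b + φ' * (a - b) < φ a := by
  rcases lt_or_gt_of_ne hab with h | h
  · have := hφ.slope_lt_of_hasDerivAt (Set.mem_univ a) (Set.mem_univ b) h hd
    rw [slope_def_field, div_lt_iff₀ (by linarith)] at this
    linarith
  · have := hφ.lt_slope_of_hasDerivAt (Set.mem_univ b) (Set.mem_univ a) h hd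
    rw [slope_def_field, lt_div_iff₀ (by linarith)] at this
    linarith

theorem _root_.ConcaveOn.le_tangent {φ : ℝ → ℝ} (hφ : ConcaveOn ℝ Set.univ φ)
    {a b φ' : ℝ} (hd : HasDerivAt φ φ' b) : φ a ≤ φ b + φ' * (a - b) := by
  rcases lt_trichotomy a b with h | h | h
  · have := hφ.le_slope_of_hasDerivAt (Set.mem_univ a) (Set.mem_univ b) h hd
    rw [slope_def_field, le_div_iff₀ (by linarith)] at this
    linarith
  · simp [h]
  · have := hφ.slope_le_of_hasDerivAt (Set.mem_univ b) (Set.mem_univ a) h hd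
    rw [slope_def_field, div_le_iff₀ (by linarith)] at this
    linarith

variable {p : ℝ}

/-- If `|x| ≠ |y|`, strictness comes from `t ^ p` on `[0, ∞)`. Otherwise `y = -x`, and it comes from
cancellation inside the absolute value. -/
theorem strictConvexOn_abs_rpow (hp : 1 < p) :
    StrictConvexOn ℝ Set.univ (fun x : ℝ => |x| ^ p) := by
  refine ⟨convex_univ, fun x _ y _ hxy a b ha hb hab => ?_⟩
  have hp0 : 0 < p := by linarith
  simp only [smul_eq_mul]
  have htri : |a * x + b * y| ≤ a * |x| + b * |y| := by
    have := abs_add_le (a * x) (b * y)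
    rwa [abs_mul, abs_mul, abs_of_pos ha, abs_of_pos hb] at this
  by_cases hne : |x| = |y|
  · have hy : y = -x := by
      rcases abs_eq_abs.1 hne with h | h
      · exact absurd h hxy
      · linarith
    have hx : 0 < |x| := by
      refine abs_pos.2 fun h0 => hxy ?_
      simp [hy, h0]
    have hlt : |a * x + b * y| < |x| := by
      have : a * x + b * y = (a - b) * x := by rw [hy]; ring
      rw [this, abs_mul]
      have : |a - b| < 1 := abs_lt.2 ⟨by linarith, by linarith⟩
      nlinarith
    calc |a * x + b * y| ^ p < |x| ^ p := Real.rpow_lt_rpow (abs_nonneg _) hlt hp0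
      _ = a * |x| ^ p + b * |y| ^ p := by rw [← hne, ← add_mul, hab, one_mul]
  · calc |a * x + b * y| ^ p ≤ (a * |x| + b * |y|) ^ p :=
          Real.rpow_le_rpow (abs_nonneg _) htri hp0.le
      _ < a * |x| ^ p + b * |y| ^ p :=
          (strictConvexOn_rpow hp).2 (abs_nonneg x) (abs_nonneg y) hne ha hb hab

/-- The monotone function `|a| ^ (p - 2) a`, the derivative of `|a| ^ p / p`. -/
def flux (p a : ℝ) : ℝ := |a| ^ (p - 2) * a

theorem flux_tangent_lt (hp : 1 < p) {a b : ℝ} (hab : a ≠ b) :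
    |b| ^ p + p * (flux p b * (a - b)) < |a| ^ p := by
  have := (strictConvexOn_abs_rpow hp).tangent_lt (hasDerivAt_abs_rpow b hp) hab
  simp only [flux]
  linarith

theorem flux_tangent_le (hp : 1 < p) (a b : ℝ) :
    |b| ^ p + p * (flux p b * (a - b)) ≤ |a| ^ p := by
  rcases eq_or_ne a b with rfl | h
  · simp
  · exact (flux_tangent_lt hp h).le

theorem flux_sub_mul_pos (hp : 1 < p) {a b : ℝ} (hab : a ≠ b) :
    0 < (flux p a - flux p b) * (a - b) := by
  have h1 := flux_tangent_lt hp hab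
  have h2 := flux_tangent_lt hp hab.symm
  have : 0 < p * ((flux p a - flux p b) * (a - b)) := by linarith
  exact pos_of_mul_pos_right this (by linarith)

theorem abs_flux (hp : 1 < p) (a : ℝ) : |flux p a| = |a| ^ (p - 1) := by
  rw [flux, abs_mul, abs_of_nonneg (Real.rpow_nonneg (abs_nonneg a) _)]
  rcases eq_or_ne a 0 with rfl | ha
  · simp [Real.zero_rpow (by linarith : p - 1 ≠ 0)]
  · rw [← Real.rpow_add_one (abs_ne_zero.2 ha)]
    ring_nf

/-- For `p < 2` the factor `|a| ^ (p - 2)` is singular at `0`, so continuity is read off from `|x| ^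
p` being `C¹`. -/
theorem continuous_flux (hp : 1 < p) : Continuous (flux p) := by
  have h1 : ContDiff ℝ 1 (fun x : ℝ => |x| ^ p) := contDiff_norm_rpow hp
  have h2 : deriv (fun x : ℝ => |x| ^ p) = fun x => p * flux p x := by
    ext x
    rw [(hasDerivAt_abs_rpow x hp).deriv, flux, _root_.mul_assoc]
  have h3 := h1.continuous_deriv le_rfl
  rw [h2] at h3
  have : flux p = fun x => p⁻¹ * (p * flux p x) := by
    ext x; field_simp
  rw [this]
  exact continuous_const.mul h3

/-- Both factors of `|a| ^ (p - 1) * |b|` are dominated by powers of `max |a| |b|`; this replaces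
Young's inequality with conjugate exponents. -/
theorem abs_flux_mul_le (hp : 1 < p) (a b : ℝ) : |flux p a * b| ≤ |a| ^ p + |b| ^ p := by
  rw [abs_mul, abs_flux hp]
  have key : ∀ c : ℝ, 0 ≤ c → c ^ (p - 1) * c = c ^ p := by
    intro c hc
    rcases hc.eq_or_lt with rfl | hc
    · simp [Real.zero_rpow (by linarith : p ≠ 0)]
    · rw [← Real.rpow_add_one hc.ne']; ring_nf
  have ha := Real.rpow_nonneg (abs_nonneg a) p
  have hb := Real.rpow_nonneg (abs_nonneg b) p
  rcases le_total |a| |b| with h | h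
  · have := mul_le_mul_of_nonneg_right
      (Real.rpow_le_rpow (abs_nonneg a) h (by linarith : 0 ≤ p - 1)) (abs_nonneg b)
    rw [key _ (abs_nonneg b)] at this
    linarith
  · have := mul_le_mul_of_nonneg_left h (Real.rpow_nonneg (abs_nonneg a) (p - 1))
    rw [key _ (abs_nonneg a)] at this
    linarith

theorem abs_sub_rpow_le (hp : 1 < p) (a b : ℝ) :
    |a - b| ^ p ≤ 2 ^ p * (|a| ^ p + |b| ^ p) := by
  have hp0 : 0 ≤ p := by linarith
  have ha := Real.rpow_nonneg (abs_nonneg a) p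
  have hb := Real.rpow_nonneg (abs_nonneg b) p
  have h1 : |a - b| ≤ 2 * max |a| |b| := by
    have := abs_sub a b
    have := le_max_left |a| |b|
    have := le_max_right |a| |b|
    linarith
  have h2 : (max |a| |b|) ^ p ≤ |a| ^ p + |b| ^ p := by
    rcases max_choice |a| |b| with h | h <;> rw [h] <;> linarith
  calc |a - b| ^ p ≤ (2 * max |a| |b|) ^ p := Real.rpow_le_rpow (abs_nonneg _) h1 hp0
    _ = 2 ^ p * (max |a| |b|) ^ p := Real.mul_rpow (by norm_num) (by positivity)
    _ ≤ _ := by gcongr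

theorem exists_abs_le_mul_rpow_add (hp : 1 < p) {ε : ℝ} (hε : 0 < ε) :
    ∃ C : ℝ, 0 ≤ C ∧ ∀ x : ℝ, |x| ≤ ε * |x| ^ p + C := by
  -- This is the threshold beyond which `ε * |x| ^ (p - 1) ≥ 1`.
  refine ⟨(ε⁻¹) ^ (1 / (p - 1)), by positivity, fun x => ?_⟩
  rcases le_total |x| ((ε⁻¹) ^ (1 / (p - 1))) with h | h
  · have : 0 ≤ ε * |x| ^ p := by positivity
    linarith
  · have hp1 : 0 < p - 1 := by linarith
    have hx : 0 < |x| := lt_of_lt_of_le (by positivity) h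
    have h1 : ε⁻¹ ≤ |x| ^ (p - 1) := by
      have := Real.rpow_le_rpow (by positivity) h hp1.le
      rwa [← Real.rpow_mul (by positivity), one_div_mul_cancel hp1.ne', Real.rpow_one] at this
    have h2 : |x| ^ p = |x| ^ (p - 1) * |x| := by
      rw [← Real.rpow_add_one hx.ne']; ring_nf
    have h3 : 1 ≤ ε * |x| ^ (p - 1) := by
      rw [inv_le_iff_one_le_mul₀ hε] at h1
      linarith
    have h4 : 0 ≤ (ε⁻¹) ^ (1 / (p - 1)) := by positivity
    rw [h2]
    nlinarith

/-- The convexity defect of `|x| ^ p` at the midpoint. -/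
def midDefect (p a b : ℝ) : ℝ := (|a| ^ p + |b| ^ p) / 2 - |(a + b) / 2| ^ p

theorem midDefect_pos (hp : 1 < p) {a b : ℝ} (hab : a ≠ b) : 0 < midDefect p a b := by
  have := (strictConvexOn_abs_rpow hp).2 (Set.mem_univ a) (Set.mem_univ b) hab
    (by norm_num : (0 : ℝ) < 1 / 2) (by norm_num : (0 : ℝ) < 1 / 2) (by norm_num)
  simp only [smul_eq_mul] at this
  have e : (a + b) / 2 = 1 / 2 * a + 1 / 2 * b := by ring
  rw [midDefect, e]
  linarith

theorem midDefect_nonneg (hp : 1 < p) (a b : ℝ) : 0 ≤ midDefect p a b := by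
  rcases eq_or_ne a b with rfl | h
  · simp [midDefect]
  · exact (midDefect_pos hp h).le

theorem midDefect_mul (p : ℝ) {r : ℝ} (hr : 0 ≤ r) (a b : ℝ) :
    midDefect p (r * a) (r * b) = r ^ p * midDefect p a b := by
  have e : (r * a + r * b) / 2 = r * ((a + b) / 2) := by ring
  rw [midDefect, midDefect, e]
  simp only [abs_mul, abs_of_nonneg hr, Real.mul_rpow hr (abs_nonneg _)]
  ring

/-- A quantitative form of uniform convexity of `|x| ^ p`, valid for every `p > 1`. -/
theorem exists_abs_sub_rpow_le_midDefect (hp : 1 < p) {ε : ℝ} (hε : 0 < ε) :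
    ∃ C : ℝ, 0 ≤ C ∧ ∀ a b : ℝ,
      |a - b| ^ p ≤ ε * (|a| ^ p + |b| ^ p) + C * midDefect p a b := by
  have hp0 : 0 < p := by linarith
  -- On the compact `ℓ¹` unit sphere, `S` is where the `ε` term alone does not give a strict
  -- inequality. It misses the diagonal, so the defect has a positive lower bound `m` there. As `|a
  -- - b| ≤ 1` on the sphere, `C = m⁻¹` suffices, and homogeneity gives the general case.
  let S : Set (ℝ × ℝ) := {z | |z.1| + |z.2| = 1 ∧ ε * (|z.1| ^ p + |z.2| ^ p) ≤ |z.1 - z.2| ^ p}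
  have hrp : ∀ φ : ℝ × ℝ → ℝ, Continuous φ → Continuous fun z => |φ z| ^ p := fun φ hφ =>
    hφ.abs.rpow_const fun _ => Or.inr hp0.le
  have c1 := hrp _ continuous_fst
  have c2 := hrp _ continuous_snd
  have c3 := hrp _ (continuous_fst.sub continuous_snd)
  have c4 := hrp _ ((continuous_fst.add continuous_snd).div_const 2)
  have hSc : IsCompact S := by
    refine Metric.isCompact_of_isClosed_isBounded ?_ ?_
    · exact (isClosed_eq (continuous_fst.abs.add continuous_snd.abs) continuous_const).inter
        (isClosed_le (continuous_const.mul (c1.add c2)) c3)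
    · refine (Metric.isBounded_closedBall (x := (0 : ℝ × ℝ)) (r := 1)).subset ?_
      rintro ⟨a, b⟩ ⟨h, -⟩
      have ha := abs_nonneg a
      have hb := abs_nonneg b
      simp only [mem_closedBall_zero_iff, Prod.norm_def, Real.norm_eq_abs, sup_le_iff]
      simp only at h
      constructor <;> linarith
  have hcont : Continuous fun z : ℝ × ℝ => midDefect p z.1 z.2 := by
    unfold midDefect
    exact ((c1.add c2).div_const 2).sub c4
  have hpos : ∀ z ∈ S, 0 < midDefect p z.1 z.2 := by
    rintro ⟨a, b⟩ ⟨h, h'⟩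
    refine midDefect_pos hp fun hab => ?_
    simp only at hab h h'
    subst hab
    rw [sub_self, abs_zero, Real.zero_rpow hp0.ne'] at h'
    have : 0 < |a| := by linarith
    have : 0 < ε * (|a| ^ p + |a| ^ p) := by positivity
    linarith
  obtain ⟨m, hm, hmS⟩ : ∃ m : ℝ, 0 < m ∧ ∀ z ∈ S, m ≤ midDefect p z.1 z.2 := by
    rcases S.eq_empty_or_nonempty with h | h
    · exact ⟨1, one_pos, by simp [h]⟩
    · obtain ⟨z, hz, hmin⟩ := hSc.exists_isMinOn h hcont.continuousOn
      exact ⟨_, hpos z hz, fun w hw => hmin hw⟩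
  refine ⟨m⁻¹, by positivity, ?_⟩
  have norm1 : ∀ a b : ℝ, |a| + |b| = 1 →
      |a - b| ^ p ≤ ε * (|a| ^ p + |b| ^ p) + m⁻¹ * midDefect p a b := by
    intro a b hab
    have hA := Real.rpow_nonneg (abs_nonneg a) p
    have hB := Real.rpow_nonneg (abs_nonneg b) p
    rcases le_total (ε * (|a| ^ p + |b| ^ p)) (|a - b| ^ p) with h | h
    · have h1 : m ≤ midDefect p a b := hmS (a, b) ⟨hab, h⟩
      have h2 : 1 ≤ m⁻¹ * midDefect p a b := by
        rw [inv_mul_eq_div, le_div_iff₀ hm]; linarith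
      have h3 : |a - b| ^ p ≤ 1 :=
        Real.rpow_le_one (abs_nonneg _) ((abs_sub a b).trans hab.le) hp0.le
      have : 0 ≤ ε * (|a| ^ p + |b| ^ p) := by positivity
      linarith
    · have : 0 ≤ m⁻¹ * midDefect p a b :=
        mul_nonneg (by positivity) (midDefect_nonneg hp a b)
      linarith
  intro a b
  rcases (add_nonneg (abs_nonneg a) (abs_nonneg b)).eq_or_lt with h0 | h0
  · have ha : a = 0 := abs_eq_zero.1 (by linarith [abs_nonneg a, abs_nonneg b])
    have hb : b = 0 := abs_eq_zero.1 (by linarith [abs_nonneg a, abs_nonneg b])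
    simp [ha, hb, midDefect, Real.zero_rpow hp0.ne']
  · set r := |a| + |b| with hr
    have ea : a = r * (a / r) := by field_simp
    have eb : b = r * (b / r) := by field_simp
    have h1 := norm1 (a / r) (b / r) (by
      rw [abs_div, abs_div, abs_of_pos h0, ← add_div, ← hr, div_self h0.ne'])
    have h2 : midDefect p a b = r ^ p * midDefect p (a / r) (b / r) := by
      rw [← midDefect_mul p h0.le, ← ea, ← eb]
    have h3 : ∀ c : ℝ, |c| ^ p = r ^ p * |c / r| ^ p := by
      intro c
      rw [← Real.mul_rpow h0.le (abs_nonneg _), abs_div, abs_of_pos h0]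
      congr 1; field_simp
    rw [h2, h3 (a - b), h3 a, h3 b, sub_div]
    have := mul_le_mul_of_nonneg_left h1 (Real.rpow_nonneg h0.le p)
    linarith

/-! ### Integrability preliminaries -/

section Lp

variable {Y : Type*} [MeasurableSpace Y] {μ : Measure Y} {p : ℝ}

theorem ofReal_ne_zero_of_one_lt (hp : 1 < p) : ENNReal.ofReal p ≠ 0 := by
  simp only [ne_eq, ENNReal.ofReal_eq_zero, not_le]; linarith

theorem one_le_ofReal_of_one_lt (hp : 1 < p) : 1 ≤ ENNReal.ofReal p :=
  ENNReal.one_le_ofReal.2 hp.le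

theorem memLp_ofReal_iff (hp : 1 < p) {w : Y → ℝ} (hw : AEStronglyMeasurable w μ) :
    MemLp w (ENNReal.ofReal p) μ ↔ Integrable (fun z => |w z| ^ p) μ := by
  rw [← integrable_norm_rpow_iff hw (ofReal_ne_zero_of_one_lt hp) ENNReal.ofReal_ne_top,
    ENNReal.toReal_ofReal (by linarith)]
  rfl

theorem integrable_abs_rpow (hp : 1 < p) {w : Y → ℝ} (hw : MemLp w (ENNReal.ofReal p) μ) :
    Integrable (fun z => |w z| ^ p) μ := (memLp_ofReal_iff hp hw.1).1 hw

theorem integrable_midDefect (hp : 1 < p) {v w : Y → ℝ} (hv : MemLp v (ENNReal.ofReal p) μ)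
    (hw : MemLp w (ENNReal.ofReal p) μ) : Integrable (fun z => midDefect p (v z) (w z)) μ := by
  unfold midDefect
  refine (((integrable_abs_rpow hp hv).add (integrable_abs_rpow hp hw)).div_const 2).sub ?_
  refine integrable_abs_rpow hp (w := fun z => (v z + w z) / 2) ?_
  have := (hv.add hw).const_mul (1 / 2)
  refine this.congr_norm ?_ (.of_forall fun z => ?_)
  · exact ((hv.1.add hw.1).div₀ aestronglyMeasurable_const)
  · simp only [Pi.add_apply]; congr 1; ring

theorem integrable_flux_mul (hp : 1 < p) {v w : Y → ℝ} (hv : MemLp v (ENNReal.ofReal p) μ)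
    (hw : MemLp w (ENNReal.ofReal p) μ) : Integrable (fun z => flux p (v z) * w z) μ := by
  refine ((integrable_abs_rpow hp hv).add (integrable_abs_rpow hp hw)).mono'
    (((continuous_flux hp).comp_aestronglyMeasurable hv.1).mul hw.1) (.of_forall fun z => ?_)
  exact abs_flux_mul_le hp _ _

/-- Fatou's lemma in Bochner form. -/
theorem integrable_and_integral_le_of_tendsto {G : ℕ → Y → ℝ} {G' : Y → ℝ} {a : ℕ → ℝ} {A : ℝ}
    (hG : ∀ k, Integrable (G k) μ) (h0 : ∀ k z, 0 ≤ G k z) (h0' : ∀ z, 0 ≤ G' z)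
    (hlim : ∀ᵐ z ∂μ, Filter.Tendsto (fun k => G k z) Filter.atTop (nhds (G' z)))
    (ha : ∀ k, ∫ z, G k z ∂μ ≤ a k) (hA : Filter.Tendsto a Filter.atTop (nhds A)) :
    Integrable G' μ ∧ ∫ z, G' z ∂μ ≤ A := by
  have hmeas : AEStronglyMeasurable G' μ :=
    aestronglyMeasurable_of_tendsto_ae _ (fun k => (hG k).1) hlim
  have hA0 : 0 ≤ A := ge_of_tendsto' hA fun k => (integral_nonneg (h0 k)).trans (ha k)
  have key : ∫⁻ z, ENNReal.ofReal (G' z) ∂μ ≤ ENNReal.ofReal A := by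
    calc ∫⁻ z, ENNReal.ofReal (G' z) ∂μ
        = ∫⁻ z, Filter.liminf (fun k => ENNReal.ofReal (G k z)) Filter.atTop ∂μ := by
          refine lintegral_congr_ae ?_
          filter_upwards [hlim] with z hz
          exact ((ENNReal.continuous_ofReal.tendsto _).comp hz).liminf_eq.symm
      _ ≤ Filter.liminf (fun k => ∫⁻ z, ENNReal.ofReal (G k z) ∂μ) Filter.atTop :=
          lintegral_liminf_le' fun k => (hG k).1.aemeasurable.ennreal_ofReal
      _ ≤ Filter.liminf (fun k => ENNReal.ofReal (a k)) Filter.atTop := by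
          refine Filter.liminf_le_liminf (.of_forall fun k => ?_)
          rw [← ofReal_integral_eq_lintegral_ofReal (hG k) (.of_forall (h0 k))]
          exact ENNReal.ofReal_le_ofReal (ha k)
      _ = ENNReal.ofReal A := ((ENNReal.continuous_ofReal.tendsto _).comp hA).liminf_eq
  have hint : Integrable G' μ := by
    refine ⟨hmeas, ?_⟩
    rw [hasFiniteIntegral_iff_ofReal (.of_forall h0')]
    exact key.trans_lt ENNReal.ofReal_lt_top
  refine ⟨hint, ?_⟩
  rw [← ofReal_integral_eq_lintegral_ofReal hint (.of_forall h0')] at key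
  exact (ENNReal.ofReal_le_ofReal_iff hA0).1 key

/-- Completeness of `L^p` in terms of `∫ |w k - w l| ^ p`. -/
theorem exists_limit_of_integral_abs_sub_rpow (hp : 1 < p) {w : ℕ → Y → ℝ}
    (hw : ∀ k, MemLp (w k) (ENNReal.ofReal p) μ)
    (hc : ∀ ε > 0, ∃ N, ∀ k ≥ N, ∀ l ≥ N, ∫ z, |w k z - w l z| ^ p ∂μ ≤ ε) :
    ∃ u : Y → ℝ, MemLp u (ENNReal.ofReal p) μ ∧
      Filter.Tendsto (fun k => ∫ z, |w k z - u z| ^ p ∂μ) Filter.atTop (nhds 0) ∧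
      ∃ ns : ℕ → ℕ, StrictMono ns ∧
        ∀ᵐ z ∂μ, Filter.Tendsto (fun k => w (ns k) z) Filter.atTop (nhds (u z)) := by
  have hp0 : 0 < p := by linarith
  have : Fact (1 ≤ ENNReal.ofReal p) := ⟨one_le_ofReal_of_one_lt hp⟩
  have hnorm : ∀ v : Y → ℝ, MemLp v (ENNReal.ofReal p) μ →
      (eLpNorm v (ENNReal.ofReal p) μ).toReal = (∫ z, |v z| ^ p ∂μ) ^ p⁻¹ := by
    intro v hv
    rw [hv.eLpNorm_eq_integral_rpow_norm (ofReal_ne_zero_of_one_lt hp) ENNReal.ofReal_ne_top,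
      ENNReal.toReal_ofReal (by positivity), ENNReal.toReal_ofReal hp0.le]
    rfl
  have hcs : CauchySeq fun k => (hw k).toLp (w k) := by
    rw [Metric.cauchySeq_iff]
    intro ε hε
    obtain ⟨N, hN⟩ := hc ((ε / 2) ^ p) (by positivity)
    refine ⟨N, fun k hk l hl => ?_⟩
    rw [dist_eq_norm, ← MemLp.toLp_sub, Lp.norm_toLp, hnorm _ ((hw k).sub (hw l))]
    have h1 := Real.rpow_le_rpow (integral_nonneg fun z => by positivity) (hN k hk l hl)
      (inv_nonneg.2 hp0.le)
    rw [Real.rpow_rpow_inv (by positivity) hp0.ne'] at h1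
    simp only [Pi.sub_apply]
    linarith
  obtain ⟨V, hV⟩ := cauchySeq_tendsto_of_complete hcs
  obtain ⟨U, hUm, rfl⟩ : ∃ (U : Y → ℝ) (hUm : MemLp U (ENNReal.ofReal p) μ), hUm.toLp U = V :=
    ⟨V, Lp.memLp V, Lp.toLp_coeFn V (Lp.memLp V)⟩
  have hUe : Filter.Tendsto (fun k => eLpNorm (w k - U) (ENNReal.ofReal p) μ)
      Filter.atTop (nhds 0) := (Lp.tendsto_Lp_iff_tendsto_eLpNorm'' w hw U hUm).1 hV
  refine ⟨U, hUm, ?_, ?_⟩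
  · have h3 : ∀ k, ∫ z, |w k z - U z| ^ p ∂μ =
        (eLpNorm (w k - U) (ENNReal.ofReal p) μ).toReal ^ p := by
      intro k
      rw [hnorm _ ((hw k).sub hUm), Real.rpow_inv_rpow (integral_nonneg fun z => by positivity)
        hp0.ne']
      rfl
    simp only [h3]
    have h4 := (ENNReal.tendsto_toReal ENNReal.zero_ne_top).comp hUe
    have h5 := h4.rpow_const (p := p) (Or.inr hp0.le)
    simpa [Real.zero_rpow hp0.ne'] using h5
  · exact (tendstoInMeasure_of_tendsto_eLpNorm (ofReal_ne_zero_of_one_lt hp)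
      (fun k => (hw k).1) hUm.1 hUe).exists_seq_tendsto_ae

end Lp

/-! ### Bounded nonincreasing nonlinearities and their primitives -/

section Primitive

variable {X : Type*} [MeasurableSpace X]

/-- A jointly measurable nonlinearity `φ ξ x` that is continuous and nonincreasing in `x` and
bounded by `M`. -/
structure IsBoundedForcing (φ : X → ℝ → ℝ) (M : ℝ) : Prop where
  measurable : Measurable (Function.uncurry φ)
  continuous : ∀ ξ, Continuous (φ ξ)
  antitone : ∀ ξ, Antitone (φ ξ)
  abs_le : ∀ ξ x, |φ ξ x| ≤ M

/-- The primitive `∫₀ˣ φ ξ τ dτ`. -/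
def primitive (φ : X → ℝ → ℝ) (ξ : X) (x : ℝ) : ℝ := ∫ τ in (0 : ℝ)..x, φ ξ τ

variable {φ : X → ℝ → ℝ} {M : ℝ}

theorem IsBoundedForcing.hasDerivAt (hφ : IsBoundedForcing φ M) (ξ : X) (x : ℝ) :
    HasDerivAt (primitive φ ξ) (φ ξ x) x :=
  intervalIntegral.integral_hasDerivAt_right ((hφ.continuous ξ).intervalIntegrable _ _)
    (hφ.continuous ξ).aestronglyMeasurable.stronglyMeasurableAtFilter (hφ.continuous ξ).continuousAt

theorem IsBoundedForcing.concaveOn (hφ : IsBoundedForcing φ M) (ξ : X) :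
    ConcaveOn ℝ Set.univ (primitive φ ξ) := by
  refine Antitone.concaveOn_univ_of_deriv (fun x => (hφ.hasDerivAt ξ x).differentiableAt) ?_
  have : deriv (primitive φ ξ) = φ ξ := by ext x; exact (hφ.hasDerivAt ξ x).deriv
  rw [this]
  exact hφ.antitone ξ

theorem IsBoundedForcing.abs_primitive_sub_le (hφ : IsBoundedForcing φ M) (ξ : X) (a b : ℝ) :
    |primitive φ ξ a - primitive φ ξ b| ≤ M * |a - b| := by
  rw [primitive, primitive, intervalIntegral.integral_interval_sub_left
    ((hφ.continuous ξ).intervalIntegrable _ _) ((hφ.continuous ξ).intervalIntegrable _ _)]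
  exact intervalIntegral.norm_integral_le_of_norm_le_const (f := φ ξ) fun x _ => hφ.abs_le ξ x

theorem IsBoundedForcing.abs_primitive_le (hφ : IsBoundedForcing φ M) (ξ : X) (a : ℝ) :
    |primitive φ ξ a| ≤ M * |a| := by
  have := hφ.abs_primitive_sub_le ξ a 0
  simpa [primitive] using this

/-- Rescaling the variable of integration by `x` gives the fixed domain `(0, 1]`, so that
measurability of parameter integrals applies. -/
theorem IsBoundedForcing.measurable_primitive (hφ : IsBoundedForcing φ M) :
    Measurable (Function.uncurry (primitive φ)) := by
  have h1 : Function.uncurry (primitive φ) = fun z : X × ℝ =>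
      z.2 * ∫ τ in Set.Ioc (0 : ℝ) 1, φ z.1 (z.2 * τ) := by
    ext z
    rw [← intervalIntegral.integral_of_le zero_le_one,
      intervalIntegral.mul_integral_comp_mul_left (f := φ z.1) z.2]
    simp [Function.uncurry, primitive]
  rw [h1]
  refine measurable_snd.mul (StronglyMeasurable.measurable ?_)
  refine StronglyMeasurable.integral_prod_right (f := fun z : X × ℝ => fun τ => φ z.1 (z.2 * τ)) ?_
  refine Measurable.stronglyMeasurable ?_
  exact hφ.measurable.comp (measurable_fst.fst.prodMk (measurable_fst.snd.mul measurable_snd))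

end Primitive

/-! ### The obstacle problem for a nonlocal energy on a measure space -/

section Increments

variable {X : Type*}

/-- The increment `u ξ - u η` at `z = (ξ, η)`. -/
def incr (u : X → ℝ) (z : X × X) : ℝ := u z.1 - u z.2

theorem incr_sub (u v : X → ℝ) : incr (u - v) = incr u - incr v := by
  ext z; simp only [incr, Pi.sub_apply]; ring

/-- The point `u + θ (v - u)` of the segment from `u` to `v`. -/
def segPoint (u v : X → ℝ) (θ : ℝ) : X → ℝ := u + θ • (v - u)

theorem incr_segPoint (u v : X → ℝ) (θ : ℝ) :
    incr (segPoint u v θ) = incr u + θ • incr (v - u) := by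
  ext z; simp only [incr, segPoint, Pi.sub_apply, Pi.add_apply, Pi.smul_apply, smul_eq_mul]; ring

end Increments

/-! ### The energy: subgradient inequality, coercivity, midpoint convexity. -/

section Obstacle

variable {X : Type*} [MeasurableSpace X]

/-- Hypotheses on the interaction measure `μ` (the kernel times `dξ dη`): absolute continuity and a
Poincaré inequality for functions that vanish outside `Ω`. -/
structure IsInteraction (ν : Measure X) (μ : Measure (X × X)) (p : ℝ) (Ω : Set X) : Prop where
  absolutelyContinuous : μ ≪ ν.prod ν
  measure_lt_top : ν Ω < ⊤
  poincare : ∃ C : ℝ, 0 ≤ C ∧ ∀ w : X → ℝ, MemLp w (ENNReal.ofReal p) ν →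
    MemLp (incr w) (ENNReal.ofReal p) μ → (∀ᵐ ξ ∂(ν.restrict Ωᶜ), w ξ = 0) →
    ∫ ξ, |w ξ| ^ p ∂ν ≤ C * ∫ z, |incr w z| ^ p ∂μ

/-- Functions of finite energy above the obstacle `h` in `Ω` and equal to `g` outside `Ω`. -/
def energyClass (ν : Measure X) (μ : Measure (X × X)) (p : ℝ) (Ω : Set X) (g : X → ℝ)
    (h : X → EReal) : Set (X → ℝ) :=
  {u | MemLp u (ENNReal.ofReal p) ν ∧ MemLp (incr u) (ENNReal.ofReal p) μ ∧
    (∀ᵐ ξ ∂(ν.restrict Ω), h ξ ≤ (u ξ : EReal)) ∧ ∀ᵐ ξ ∂(ν.restrict Ωᶜ), u ξ = g ξ}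

/-- The energy whose Euler–Lagrange operator is `weakForm`. -/
def energy (ν : Measure X) (μ : Measure (X × X)) (p : ℝ) (Ω : Set X) (φ : X → ℝ → ℝ)
    (u : X → ℝ) : ℝ :=
  p⁻¹ * ∫ z, |incr u z| ^ p ∂μ - ∫ ξ in Ω, primitive φ ξ (u ξ) ∂ν

/-- The first variation of `energy` at `u` in direction `v`. -/
def weakForm (ν : Measure X) (μ : Measure (X × X)) (p : ℝ) (Ω : Set X) (φ : X → ℝ → ℝ)
    (u v : X → ℝ) : ℝ :=
  (∫ z, flux p (incr u z) * incr v z ∂μ) - ∫ ξ in Ω, φ ξ (u ξ) * v ξ ∂ν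

variable {ν : Measure X} {μ : Measure (X × X)} {p : ℝ} {Ω : Set X} {g : X → ℝ} {h : X → EReal}
  {φ : X → ℝ → ℝ} {M : ℝ} {u v : X → ℝ}

theorem segPoint_mem (hu : u ∈ energyClass ν μ p Ω g h) (hv : v ∈ energyClass ν μ p Ω g h)
    {θ : ℝ} (h0 : 0 ≤ θ) (h1 : θ ≤ 1) : segPoint u v θ ∈ energyClass ν μ p Ω g h := by
  refine ⟨hu.1.add ((hv.1.sub hu.1).const_smul θ), ?_, ?_, ?_⟩
  · rw [incr_segPoint, incr_sub]
    exact hu.2.1.add ((hv.2.1.sub hu.2.1).const_smul θ)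
  · filter_upwards [hu.2.2.1, hv.2.2.1] with ξ h2 h3
    simp only [segPoint, Pi.add_apply, Pi.smul_apply, Pi.sub_apply, smul_eq_mul]
    rcases le_total (u ξ) (v ξ) with h4 | h4
    · exact h2.trans (EReal.coe_le_coe_iff.2 (by nlinarith))
    · exact h3.trans (EReal.coe_le_coe_iff.2 (by nlinarith))
  · filter_upwards [hu.2.2.2, hv.2.2.2] with ξ h2 h3
    simp [segPoint, h2, h3]

/-- This makes the Poincaré inequality available for differences of competitors. -/
theorem sub_eq_zero_of_mem (hu : u ∈ energyClass ν μ p Ω g h)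
    (hv : v ∈ energyClass ν μ p Ω g h) : ∀ᵐ ξ ∂(ν.restrict Ωᶜ), (v - u) ξ = 0 := by
  filter_upwards [hu.2.2.2, hv.2.2.2] with ξ h2 h3
  simp [h2, h3]

theorem IsInteraction.integrableOn (hμ : IsInteraction ν μ p Ω) (hp : 1 < p)
    (hu : MemLp u (ENNReal.ofReal p) ν) : IntegrableOn u Ω ν := by
  have : IsFiniteMeasure (ν.restrict Ω) := ⟨by simpa using hμ.measure_lt_top⟩
  exact (hu.restrict Ω).integrable (one_le_ofReal_of_one_lt hp)

theorem IsBoundedForcing.integrableOn_mul (hφ : IsBoundedForcing φ M)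
    (hμ : IsInteraction ν μ p Ω) (hp : 1 < p) (hu : MemLp u (ENNReal.ofReal p) ν)
    (hv : MemLp v (ENNReal.ofReal p) ν) : IntegrableOn (fun ξ => φ ξ (u ξ) * v ξ) Ω ν := by
  refine (hμ.integrableOn hp hv).bdd_mul (c := M) ?_ (.of_forall fun ξ => hφ.abs_le ξ _)
  exact (hφ.measurable.comp_aemeasurable
    (aemeasurable_id.prodMk (hu.1.aemeasurable.mono_measure Measure.restrict_le_self)))
    |>.aestronglyMeasurable

theorem IsBoundedForcing.integrableOn_primitive (hφ : IsBoundedForcing φ M)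
    (hμ : IsInteraction ν μ p Ω) (hp : 1 < p) (hu : MemLp u (ENNReal.ofReal p) ν) :
    IntegrableOn (fun ξ => primitive φ ξ (u ξ)) Ω ν := by
  refine ((hμ.integrableOn hp hu).abs.const_mul M).mono' ?_
    (.of_forall fun ξ => hφ.abs_primitive_le ξ _)
  exact (hφ.measurable_primitive.comp_aemeasurable
    (aemeasurable_id.prodMk (hu.1.aemeasurable.mono_measure Measure.restrict_le_self)))
    |>.aestronglyMeasurable

theorem integrable_flux_incr_mul (hp : 1 < p) (hu : MemLp (incr u) (ENNReal.ofReal p) μ)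
    (hv : MemLp (incr v) (ENNReal.ofReal p) μ) :
    Integrable (fun z => flux p (incr u z) * incr v z) μ := integrable_flux_mul hp hu hv

theorem setIntegral_abs_rpow_le (hp : 1 < p) (hu : MemLp u (ENNReal.ofReal p) ν) :
    ∫ ξ in Ω, |u ξ| ^ p ∂ν ≤ ∫ ξ, |u ξ| ^ p ∂ν :=
  setIntegral_le_integral (integrable_abs_rpow hp hu) (.of_forall fun ξ => by positivity)

/-- Subgradient inequality for the energy. -/
theorem weakForm_sub_le (hp : 1 < p) (hμ : IsInteraction ν μ p Ω) (hφ : IsBoundedForcing φ M)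
    (hu : u ∈ energyClass ν μ p Ω g h) (hv : v ∈ energyClass ν μ p Ω g h) :
    weakForm ν μ p Ω φ u (v - u) ≤ energy ν μ p Ω φ v - energy ν μ p Ω φ u := by
  have hp0 : 0 < p := by linarith
  have h1 : ∫ z, flux p (incr u z) * incr (v - u) z ∂μ ≤
      p⁻¹ * ∫ z, |incr v z| ^ p ∂μ - p⁻¹ * ∫ z, |incr u z| ^ p ∂μ := by
    rw [← mul_sub, ← integral_sub (integrable_abs_rpow hp hv.2.1) (integrable_abs_rpow hp hu.2.1),
      ← integral_const_mul]
    refine integral_mono (integrable_flux_incr_mul hp hu.2.1 ?_)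
      (((integrable_abs_rpow hp hv.2.1).sub (integrable_abs_rpow hp hu.2.1)).const_mul _) ?_
    · rw [incr_sub]; exact hv.2.1.sub hu.2.1
    · intro z
      have := flux_tangent_le hp (incr v z) (incr u z)
      simp only [incr_sub, Pi.sub_apply]
      rw [inv_mul_eq_div, le_div_iff₀ hp0]
      linarith
  have h2 : ∫ ξ in Ω, primitive φ ξ (v ξ) ∂ν - ∫ ξ in Ω, primitive φ ξ (u ξ) ∂ν ≤
      ∫ ξ in Ω, φ ξ (u ξ) * (v - u) ξ ∂ν := by
    rw [← integral_sub (hφ.integrableOn_primitive hμ hp hv.1)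
      (hφ.integrableOn_primitive hμ hp hu.1)]
    refine integral_mono ((hφ.integrableOn_primitive hμ hp hv.1).sub
      (hφ.integrableOn_primitive hμ hp hu.1))
      (hφ.integrableOn_mul hμ hp hu.1 (hv.1.sub hu.1)) fun ξ => ?_
    have := (hφ.concaveOn ξ).le_tangent (a := v ξ) (hφ.hasDerivAt ξ (u ξ))
    simp only [Pi.sub_apply]
    linarith
  unfold weakForm energy
  linarith

/-- Coercivity of the energy. -/
theorem exists_le_energy (hp : 1 < p) (hμ : IsInteraction ν μ p Ω) (hφ : IsBoundedForcing φ M)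
    (hM : 0 ≤ M) {u₀ : X → ℝ} (hu₀ : u₀ ∈ energyClass ν μ p Ω g h) :
    ∃ B : ℝ, ∀ u ∈ energyClass ν μ p Ω g h,
      (2 * p)⁻¹ * ∫ z, |incr u z| ^ p ∂μ - B ≤ energy ν μ p Ω φ u := by
  have hp0 : 0 < p := by linarith
  obtain ⟨C, hC, hP⟩ := hμ.poincare
  -- With this `ε`, Poincaré bounds the lower order term by `(2 * p)⁻¹` times the energies of `u`
  -- and `u₀`, plus constants; half of the leading term `p⁻¹ * E` absorbs it.
  obtain ⟨D, hD, hY⟩ := exists_abs_le_mul_rpow_add hp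
    (ε := (2 * p * (M * C * 2 ^ p + 1))⁻¹) (by positivity)
  set ε := (2 * p * (M * C * 2 ^ p + 1))⁻¹ with hε
  have hε0 : 0 < ε := by positivity
  have hεM : M * (ε * (C * 2 ^ p)) ≤ (2 * p)⁻¹ := by
    rw [hε, mul_inv]
    have : M * C * 2 ^ p * (M * C * 2 ^ p + 1)⁻¹ ≤ 1 := by
      rw [← div_eq_mul_inv, div_le_one (by positivity)]; linarith
    calc M * ((2 * p)⁻¹ * (M * C * 2 ^ p + 1)⁻¹ * (C * 2 ^ p))
        = (2 * p)⁻¹ * (M * C * 2 ^ p * (M * C * 2 ^ p + 1)⁻¹) := by ring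
      _ ≤ (2 * p)⁻¹ * 1 := by gcongr
      _ = _ := mul_one _
  refine ⟨(2 * p)⁻¹ * ∫ z, |incr u₀ z| ^ p ∂μ + M * (D * (ν.restrict Ω).real Set.univ) +
    M * ∫ ξ in Ω, |u₀ ξ| ∂ν, fun u hu => ?_⟩
  have : IsFiniteMeasure (ν.restrict Ω) := ⟨by simpa using hμ.measure_lt_top⟩
  have hdI : MemLp (incr (u - u₀)) (ENNReal.ofReal p) μ := by
    rw [incr_sub]; exact hu.2.1.sub hu₀.2.1
  have h1 : ∫ ξ in Ω, primitive φ ξ (u ξ) ∂ν ≤ M * ∫ ξ in Ω, |u ξ| ∂ν := by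
    rw [← integral_const_mul]
    exact integral_mono (hφ.integrableOn_primitive hμ hp hu.1)
      ((hμ.integrableOn hp hu.1).abs.const_mul M)
      fun ξ => (le_abs_self _).trans (hφ.abs_primitive_le ξ _)
  have h2 : ∫ ξ in Ω, |u ξ| ∂ν ≤ ∫ ξ in Ω, |(u - u₀) ξ| ∂ν + ∫ ξ in Ω, |u₀ ξ| ∂ν := by
    rw [← integral_add (hμ.integrableOn hp (hu.1.sub hu₀.1)).abs (hμ.integrableOn hp hu₀.1).abs]
    refine integral_mono (hμ.integrableOn hp hu.1).abs
      ((hμ.integrableOn hp (hu.1.sub hu₀.1)).abs.add (hμ.integrableOn hp hu₀.1).abs) fun ξ => ?_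
    have := abs_add_le (u ξ - u₀ ξ) (u₀ ξ)
    simpa using this
  have h3 : ∫ ξ in Ω, |(u - u₀) ξ| ∂ν ≤
      ε * ∫ ξ in Ω, |(u - u₀) ξ| ^ p ∂ν + D * (ν.restrict Ω).real Set.univ := by
    have hI := (integrable_abs_rpow hp (hu.1.sub hu₀.1)).integrableOn (s := Ω)
    have := integral_mono (hμ.integrableOn hp (hu.1.sub hu₀.1)).abs
      ((hI.const_mul ε).add (integrable_const D)) fun ξ => hY ((u - u₀) ξ)
    simp only [Pi.add_apply] at this
    rw [integral_add (hI.const_mul ε) (integrable_const D), integral_const_mul, integral_const,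
      smul_eq_mul] at this
    linarith
  have h4 := (setIntegral_abs_rpow_le (Ω := Ω) hp (hu.1.sub hu₀.1)).trans
    (hP _ (hu.1.sub hu₀.1) hdI (sub_eq_zero_of_mem hu₀ hu))
  have h5 : ∫ z, |incr (u - u₀) z| ^ p ∂μ ≤
      2 ^ p * (∫ z, |incr u z| ^ p ∂μ + ∫ z, |incr u₀ z| ^ p ∂μ) := by
    rw [← integral_add (integrable_abs_rpow hp hu.2.1) (integrable_abs_rpow hp hu₀.2.1),
      ← integral_const_mul]
    refine integral_mono (integrable_abs_rpow hp hdI)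
      (((integrable_abs_rpow hp hu.2.1).add (integrable_abs_rpow hp hu₀.2.1)).const_mul _)
      fun z => ?_
    rw [incr_sub]
    exact abs_sub_rpow_le hp _ _
  have hE : 0 ≤ ∫ z, |incr u z| ^ p ∂μ + ∫ z, |incr u₀ z| ^ p ∂μ :=
    add_nonneg (integral_nonneg fun z => by positivity) (integral_nonneg fun z => by positivity)
  set E := ∫ z, |incr u z| ^ p ∂μ
  set E₀ := ∫ z, |incr u₀ z| ^ p ∂μ
  have h6 : M * (ε * ∫ ξ in Ω, |(u - u₀) ξ| ^ p ∂ν) ≤ (2 * p)⁻¹ * (E + E₀) := by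
    calc M * (ε * ∫ ξ in Ω, |(u - u₀) ξ| ^ p ∂ν) ≤ M * (ε * (C * (2 ^ p * (E + E₀)))) := by
          gcongr
          exact h4.trans (by gcongr)
      _ = M * (ε * (C * 2 ^ p)) * (E + E₀) := by ring
      _ ≤ _ := by gcongr
  have h7 : ∫ ξ in Ω, primitive φ ξ (u ξ) ∂ν ≤ M * (ε * ∫ ξ in Ω, |(u - u₀) ξ| ^ p ∂ν) +
      M * (D * (ν.restrict Ω).real Set.univ) + M * ∫ ξ in Ω, |u₀ ξ| ∂ν := by
    refine h1.trans ?_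
    rw [← mul_add, ← mul_add]
    gcongr
    linarith
  have h8 : p⁻¹ * E = (2 * p)⁻¹ * E + (2 * p)⁻¹ * E := by
    rw [mul_inv]; ring
  unfold energy
  linarith

/-- Quantitative midpoint convexity of the energy. -/
theorem integral_midDefect_le (hp : 1 < p) (hμ : IsInteraction ν μ p Ω)
    (hφ : IsBoundedForcing φ M) (hu : u ∈ energyClass ν μ p Ω g h)
    (hv : v ∈ energyClass ν μ p Ω g h) :
    p⁻¹ * ∫ z, midDefect p (incr u z) (incr v z) ∂μ ≤
      (energy ν μ p Ω φ u + energy ν μ p Ω φ v) / 2 - energy ν μ p Ω φ (segPoint u v (1 / 2)) := by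
  have hm := segPoint_mem hu hv (θ := 1 / 2) (by norm_num) (by norm_num)
  have h1 : ∫ z, midDefect p (incr u z) (incr v z) ∂μ =
      (∫ z, |incr u z| ^ p ∂μ + ∫ z, |incr v z| ^ p ∂μ) / 2 -
        ∫ z, |incr (segPoint u v (1 / 2)) z| ^ p ∂μ := by
    have hI : Integrable (fun z => (|incr u z| ^ p + |incr v z| ^ p) / 2) μ :=
      ((integrable_abs_rpow hp hu.2.1).add (integrable_abs_rpow hp hv.2.1)).div_const 2
    rw [← integral_add (integrable_abs_rpow hp hu.2.1) (integrable_abs_rpow hp hv.2.1),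
      ← integral_div, ← integral_sub hI (integrable_abs_rpow hp hm.2.1)]
    refine integral_congr_ae (.of_forall fun z => ?_)
    have : incr (segPoint u v (1 / 2)) z = (incr u z + incr v z) / 2 := by
      rw [incr_segPoint, incr_sub]
      simp only [Pi.add_apply, Pi.smul_apply, Pi.sub_apply, smul_eq_mul]; ring
    simp only [midDefect, this]
  -- The defect of the leading term is exact; concavity of the primitive gives the lower order term
  -- the favourable sign.
  have h2 : (∫ ξ in Ω, primitive φ ξ (u ξ) ∂ν + ∫ ξ in Ω, primitive φ ξ (v ξ) ∂ν) / 2 ≤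
      ∫ ξ in Ω, primitive φ ξ (segPoint u v (1 / 2) ξ) ∂ν := by
    rw [← integral_add (hφ.integrableOn_primitive hμ hp hu.1)
      (hφ.integrableOn_primitive hμ hp hv.1), ← integral_div]
    refine integral_mono (((hφ.integrableOn_primitive hμ hp hu.1).add
      (hφ.integrableOn_primitive hμ hp hv.1)).div_const 2)
      (hφ.integrableOn_primitive hμ hp hm.1) fun ξ => ?_
    have h3 := (hφ.concaveOn ξ).2 (Set.mem_univ (u ξ)) (Set.mem_univ (v ξ))
      (by norm_num : (0 : ℝ) ≤ 1 / 2) (by norm_num : (0 : ℝ) ≤ 1 / 2) (by norm_num)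
    have h4 : segPoint u v (1 / 2) ξ = (1 / 2 : ℝ) • u ξ + (1 / 2 : ℝ) • v ξ := by
      simp only [segPoint, Pi.add_apply, Pi.smul_apply, Pi.sub_apply, smul_eq_mul]; ring
    rw [h4]
    simp only [smul_eq_mul] at h3 ⊢
    linarith
  rw [h1]
  unfold energy
  have : p⁻¹ * ((∫ z, |incr u z| ^ p ∂μ + ∫ z, |incr v z| ^ p ∂μ) / 2 -
        ∫ z, |incr (segPoint u v (1 / 2)) z| ^ p ∂μ) = (p⁻¹ * (∫ z, |incr u z| ^ p ∂μ) +
        p⁻¹ * ∫ z, |incr v z| ^ p ∂μ) / 2 -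
        p⁻¹ * ∫ z, |incr (segPoint u v (1 / 2)) z| ^ p ∂μ := by ring
  linarith

end Obstacle

/-! ### Existence and uniqueness for the abstract variational inequality. -/

section Solution

variable {X : Type*} [MeasurableSpace X] {ν : Measure X} {μ : Measure (X × X)} {p : ℝ} {Ω : Set X}
  {g : X → ℝ} {h : X → EReal} {φ : X → ℝ → ℝ} {M : ℝ} {u v : X → ℝ}

/-- Minimising sequences are Cauchy in the energy seminorm. -/
theorem exists_forall_integral_incr_sub_le (hp : 1 < p) (hμ : IsInteraction ν μ p Ω)
    (hφ : IsBoundedForcing φ M) {m R : ℝ}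
    (hm : ∀ v ∈ energyClass ν μ p Ω g h, m ≤ energy ν μ p Ω φ v)
    {w : ℕ → X → ℝ} (hw : ∀ k, w k ∈ energyClass ν μ p Ω g h)
    (hR : ∀ k, ∫ z, |incr (w k) z| ^ p ∂μ ≤ R)
    (hlim : Filter.Tendsto (fun k => energy ν μ p Ω φ (w k)) Filter.atTop (nhds m))
    {ε : ℝ} (hε : 0 < ε) :
    ∃ N, ∀ k ≥ N, ∀ l ≥ N, ∫ z, |incr (w k - w l) z| ^ p ∂μ ≤ ε := by
  have hp0 : 0 < p := by linarith
  have hR0 : 0 ≤ R := (integral_nonneg fun z => by positivity).trans (hR 0)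
  -- The two energies add up to at most `2 * R`, so this `ε` contributes at most `ε / 2`. The other
  -- half is the defect, controlled by the energy gap because the midpoint is admissible and has
  -- energy at least `m`.
  obtain ⟨C, hC, hU⟩ := exists_abs_sub_rpow_le_midDefect hp
    (ε := ε / (4 * (R + 1))) (by positivity)
  obtain ⟨N, hN⟩ := Filter.eventually_atTop.1
    (hlim.eventually_lt_const (lt_add_of_pos_right m (show 0 < ε / (2 * p * (C + 1)) by positivity)))
  refine ⟨N, fun k hk l hl => ?_⟩
  have hk' := hN k hk
  have hl' := hN l hl
  have h1 := integral_midDefect_le hp hμ hφ (hw k) (hw l)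
  have h2 := hm _ (segPoint_mem (hw k) (hw l) (θ := 1 / 2) (by norm_num) (by norm_num))
  have h3 : ∫ z, midDefect p (incr (w k) z) (incr (w l) z) ∂μ ≤ ε / (2 * (C + 1)) := by
    have h4 : p⁻¹ * ∫ z, midDefect p (incr (w k) z) (incr (w l) z) ∂μ ≤
        ε / (2 * p * (C + 1)) := by linarith
    rw [inv_mul_le_iff₀ hp0] at h4
    refine h4.trans (le_of_eq ?_)
    field_simp
  have hD := integrable_midDefect hp (hw k).2.1 (hw l).2.1
  have hS : Integrable (fun z => |incr (w k) z| ^ p + |incr (w l) z| ^ p) μ :=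
    (integrable_abs_rpow hp (hw k).2.1).add (integrable_abs_rpow hp (hw l).2.1)
  have h5 : ∫ z, |incr (w k - w l) z| ^ p ∂μ ≤
      ε / (4 * (R + 1)) * (∫ z, |incr (w k) z| ^ p ∂μ + ∫ z, |incr (w l) z| ^ p ∂μ) +
        C * ∫ z, midDefect p (incr (w k) z) (incr (w l) z) ∂μ := by
    rw [← integral_add (integrable_abs_rpow hp (hw k).2.1) (integrable_abs_rpow hp (hw l).2.1),
      ← integral_const_mul, ← integral_const_mul, ← integral_add (hS.const_mul _) (hD.const_mul _)]
    refine integral_mono ?_ ((hS.const_mul _).add (hD.const_mul _)) fun z => ?_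
    · refine integrable_abs_rpow hp ?_
      rw [incr_sub]; exact (hw k).2.1.sub (hw l).2.1
    · rw [incr_sub]
      exact hU _ _
  refine h5.trans ?_
  have h6 : ε / (4 * (R + 1)) * (∫ z, |incr (w k) z| ^ p ∂μ + ∫ z, |incr (w l) z| ^ p ∂μ) ≤
      ε / 2 := by
    calc ε / (4 * (R + 1)) * (∫ z, |incr (w k) z| ^ p ∂μ + ∫ z, |incr (w l) z| ^ p ∂μ)
        ≤ ε / (4 * (R + 1)) * (2 * (R + 1)) := by
          gcongr
          linarith [hR k, hR l]
      _ = ε / 2 := by field_simp; norm_num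
  have h7 : C * ∫ z, midDefect p (incr (w k) z) (incr (w l) z) ∂μ ≤ ε / 2 := by
    calc C * ∫ z, midDefect p (incr (w k) z) (incr (w l) z) ∂μ
        ≤ (C + 1) * (ε / (2 * (C + 1))) :=
          mul_le_mul (by linarith) h3 (integral_nonneg fun z => midDefect_nonneg hp _ _)
            (by linarith)
      _ = ε / 2 := by field_simp
  linarith

/-- The lower order term of the energy is continuous in `L^p`. -/
theorem IsBoundedForcing.tendsto_integral_primitive (hφ : IsBoundedForcing φ M) (hM : 0 ≤ M)
    (hμ : IsInteraction ν μ p Ω) (hp : 1 < p) {w : ℕ → X → ℝ}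
    (hw : ∀ k, MemLp (w k) (ENNReal.ofReal p) ν) (hu : MemLp u (ENNReal.ofReal p) ν)
    (hlim : Filter.Tendsto (fun k => ∫ ξ, |w k ξ - u ξ| ^ p ∂ν) Filter.atTop (nhds 0)) :
    Filter.Tendsto (fun k => ∫ ξ in Ω, primitive φ ξ (w k ξ) ∂ν) Filter.atTop
      (nhds (∫ ξ in Ω, primitive φ ξ (u ξ) ∂ν)) := by
  have : IsFiniteMeasure (ν.restrict Ω) := ⟨by simpa using hμ.measure_lt_top⟩
  set T := (ν.restrict Ω).real Set.univ
  have hT : 0 ≤ T := measureReal_nonneg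
  -- Splitting at `|x| = δ` gives `|x| ≤ δ + δ ^ (1 - p) * |x| ^ p`. First `δ` is fixed to make the
  -- first part small, then `k` tends to infinity.
  have hbound : ∀ δ : ℝ, 0 < δ → ∀ k, |∫ ξ in Ω, primitive φ ξ (w k ξ) ∂ν -
      ∫ ξ in Ω, primitive φ ξ (u ξ) ∂ν| ≤
      M * (δ * T + δ ^ (1 - p) * ∫ ξ, |w k ξ - u ξ| ^ p ∂ν) := by
    intro δ hδ k
    have hd := (hw k).sub hu
    have hI := (integrable_abs_rpow hp hd).integrableOn (s := Ω)
    have h1 : ∀ x : ℝ, |x| ≤ δ + δ ^ (1 - p) * |x| ^ p := by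
      intro x
      rcases le_total |x| δ with hx | hx
      · have : 0 ≤ δ ^ (1 - p) * |x| ^ p := by positivity
        linarith
      · have hx0 : 0 < |x| := hδ.trans_le hx
        have h2 : |x| ^ p = |x| ^ (p - 1) * |x| := by
          rw [← Real.rpow_add_one hx0.ne']; ring_nf
        have h3 : 1 ≤ δ ^ (1 - p) * |x| ^ (p - 1) := by
          have : δ ^ (1 - p) * δ ^ (p - 1) = 1 := by
            rw [← Real.rpow_add hδ]; simp
          refine this.ge.trans ?_
          exact mul_le_mul_of_nonneg_left (Real.rpow_le_rpow hδ.le hx (by linarith))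
            (by positivity)
        rw [h2]
        nlinarith
    rw [← integral_sub (hφ.integrableOn_primitive hμ hp (hw k))
      (hφ.integrableOn_primitive hμ hp hu)]
    calc |∫ ξ in Ω, (primitive φ ξ (w k ξ) - primitive φ ξ (u ξ)) ∂ν|
        ≤ ∫ ξ in Ω, |primitive φ ξ (w k ξ) - primitive φ ξ (u ξ)| ∂ν :=
          abs_integral_le_integral_abs
      _ ≤ ∫ ξ in Ω, M * (δ + δ ^ (1 - p) * |(w k - u) ξ| ^ p) ∂ν := by
          refine integral_mono ((hφ.integrableOn_primitive hμ hp (hw k)).sub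
            (hφ.integrableOn_primitive hμ hp hu)).abs
            (((integrable_const δ).add (hI.const_mul _)).const_mul M) fun ξ => ?_
          refine (hφ.abs_primitive_sub_le ξ _ _).trans ?_
          exact mul_le_mul_of_nonneg_left (h1 _) hM
      _ = M * (δ * T + δ ^ (1 - p) * ∫ ξ in Ω, |(w k - u) ξ| ^ p ∂ν) := by
          rw [integral_const_mul, integral_add (integrable_const δ) (hI.const_mul _),
            integral_const_mul, integral_const, smul_eq_mul, mul_comm δ]
      _ ≤ _ := by
          gcongr
          exact setIntegral_abs_rpow_le hp hd
  rw [Metric.tendsto_atTop']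
  intro ε hε
  have hδ : 0 < ε / (2 * ((M + 1) * (T + 1))) := by positivity
  have h0 := (hlim.const_mul (M * (ε / (2 * ((M + 1) * (T + 1)))) ^ (1 - p)))
  rw [mul_zero] at h0
  obtain ⟨N, hN⟩ := Filter.eventually_atTop.1 (h0.eventually_lt_const (half_pos hε))
  refine ⟨N, fun k hk => ?_⟩
  rw [Real.dist_eq]
  refine (hbound _ hδ k).trans_lt ?_
  have h2 := hN k hk.le
  have h3 : M * (ε / (2 * ((M + 1) * (T + 1))) * T) ≤ ε / 2 := by
    calc M * (ε / (2 * ((M + 1) * (T + 1))) * T)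
        ≤ (M + 1) * (ε / (2 * ((M + 1) * (T + 1))) * (T + 1)) := by gcongr <;> linarith
      _ = ε / 2 := by field_simp
  rw [mul_add, ← _root_.mul_assoc M (_ ^ (1 - p))]
  linarith

/-- Exceptional null sets pull back along both projections to null sets of `ν.prod ν`, hence of `μ`.
-/
theorem tendsto_incr_ae [SFinite ν] (hμ : IsInteraction ν μ p Ω) {w : ℕ → X → ℝ}
    (hlim : ∀ᵐ ξ ∂ν, Filter.Tendsto (fun k => w k ξ) Filter.atTop (nhds (u ξ))) :
    ∀ᵐ z ∂μ, Filter.Tendsto (fun k => incr (w k) z) Filter.atTop (nhds (incr u z)) := by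
  refine hμ.absolutelyContinuous.ae_le ?_
  filter_upwards [Measure.quasiMeasurePreserving_fst.ae hlim,
    Measure.quasiMeasurePreserving_snd.ae hlim] with z h1 h2
  exact h1.sub h2

/-- The energy attains its minimum on the admissible class. -/
theorem exists_energy_minimizer [SFinite ν] (hp : 1 < p) (hμ : IsInteraction ν μ p Ω)
    (hφ : IsBoundedForcing φ M) (hM : 0 ≤ M) (hne : (energyClass ν μ p Ω g h).Nonempty) :
    ∃ u ∈ energyClass ν μ p Ω g h, ∀ v ∈ energyClass ν μ p Ω g h,
      energy ν μ p Ω φ u ≤ energy ν μ p Ω φ v := by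
  have hp0 : 0 < p := by linarith
  obtain ⟨u₀, hu₀⟩ := hne
  obtain ⟨B, hB⟩ := exists_le_energy hp hμ hφ hM hu₀
  set S := energy ν μ p Ω φ '' energyClass ν μ p Ω g h
  have hSne : S.Nonempty := ⟨_, u₀, hu₀, rfl⟩
  have hSb : BddBelow S := by
    refine ⟨-B, ?_⟩
    rintro _ ⟨u, hu, rfl⟩
    have h1 : 0 ≤ (2 * p)⁻¹ * ∫ z, |incr u z| ^ p ∂μ :=
      mul_nonneg (by positivity) (integral_nonneg fun z => by positivity)
    linarith [hB u hu]
  have hm : ∀ v ∈ energyClass ν μ p Ω g h, sInf S ≤ energy ν μ p Ω φ v :=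
    fun v hv => csInf_le hSb ⟨v, hv, rfl⟩
  obtain ⟨a, ha, halim, haS⟩ := exists_seq_tendsto_sInf hSne hSb
  choose w hw hwa using haS
  have hlim : Filter.Tendsto (fun k => energy ν μ p Ω φ (w k)) Filter.atTop (nhds (sInf S)) := by
    simpa only [hwa] using halim
  have hR : ∀ k, ∫ z, |incr (w k) z| ^ p ∂μ ≤ 2 * p * (a 0 + B) := by
    intro k
    have h1 := hB _ (hw k)
    have h2 : a k ≤ a 0 := ha (Nat.zero_le k)
    rw [hwa] at h1
    rw [← inv_mul_le_iff₀ (by positivity)]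
    linarith
  obtain ⟨C, hC, hP⟩ := hμ.poincare
  -- Poincaré upgrades the Cauchy property from the energy seminorm to `L^p`.
  have hcauchy : ∀ ε > 0, ∃ N, ∀ k ≥ N, ∀ l ≥ N, ∫ ξ, |w k ξ - w l ξ| ^ p ∂ν ≤ ε := by
    intro ε hε
    obtain ⟨N, hN⟩ := exists_forall_integral_incr_sub_le hp hμ hφ hm hw hR hlim
      (ε := ε / (C + 1)) (by positivity)
    refine ⟨N, fun k hk l hl => ?_⟩
    have h1 := hP (w k - w l) ((hw k).1.sub (hw l).1)
      (by rw [incr_sub]; exact (hw k).2.1.sub (hw l).2.1) (sub_eq_zero_of_mem (hw l) (hw k))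
    calc ∫ ξ, |w k ξ - w l ξ| ^ p ∂ν ≤ C * ∫ z, |incr (w k - w l) z| ^ p ∂μ := h1
      _ ≤ (C + 1) * (ε / (C + 1)) :=
          mul_le_mul (by linarith) (hN k hk l hl) (integral_nonneg fun z => by positivity)
            (by linarith)
      _ = ε := by field_simp
  obtain ⟨u, hu, huL, ns, hns, hae⟩ :=
    exists_limit_of_integral_abs_sub_rpow hp (fun k => (hw k).1) hcauchy
  have hprim := (hφ.tendsto_integral_primitive hM hμ hp (fun k => (hw k).1) hu huL).comp
    hns.tendsto_atTop
  have hen := hlim.comp hns.tendsto_atTop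
  have hinc := tendsto_incr_ae hμ hae
  have hincm : AEStronglyMeasurable (incr u) μ :=
    aestronglyMeasurable_of_tendsto_ae _ (fun k => (hw (ns k)).2.1.1) hinc
  -- Here `a k` is the Gagliardo energy of `w (ns k)`, written through the total energy and the
  -- primitive term, whose limits are both known. Fatou then gives finite energy of `u` and
  -- minimality at once.
  obtain ⟨hint, hle⟩ := integrable_and_integral_le_of_tendsto
    (G := fun k z => |incr (w (ns k)) z| ^ p) (G' := fun z => |incr u z| ^ p)
    (a := fun k => p * (energy ν μ p Ω φ (w (ns k)) +
      ∫ ξ in Ω, primitive φ ξ (w (ns k) ξ) ∂ν))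
    (A := p * (sInf S + ∫ ξ in Ω, primitive φ ξ (u ξ) ∂ν))
    (fun k => integrable_abs_rpow hp (hw (ns k)).2.1) (fun k z => by positivity)
    (fun z => by positivity)
    (hinc.mono fun z hz => hz.abs.rpow_const (Or.inr hp0.le))
    (fun k => by
      simp only [energy, sub_add_cancel]
      rw [← _root_.mul_assoc, mul_inv_cancel₀ hp0.ne', one_mul])
    ((hen.add hprim).const_mul p)
  have huK : u ∈ energyClass ν μ p Ω g h := by
    refine ⟨hu, (memLp_ofReal_iff hp hincm).2 hint, ?_, ?_⟩
    · filter_upwards [ae_restrict_of_ae hae, ae_all_iff.2 fun k => (hw (ns k)).2.2.1] with ξ h1 h2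
      exact ge_of_tendsto' ((continuous_coe_real_ereal.tendsto _).comp h1) h2
    · filter_upwards [ae_restrict_of_ae hae, ae_all_iff.2 fun k => (hw (ns k)).2.2.2] with ξ h1 h2
      simp only [h2] at h1
      exact tendsto_nhds_unique h1 tendsto_const_nhds
  refine ⟨u, huK, fun v hv => le_trans ?_ (hm v hv)⟩
  unfold energy
  rw [sub_le_iff_le_add, inv_mul_le_iff₀ hp0]
  exact hle

theorem weakForm_smul (u v : X → ℝ) (c : ℝ) :
    weakForm ν μ p Ω φ u (c • v) = c * weakForm ν μ p Ω φ u v := by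
  unfold weakForm
  rw [mul_sub, ← integral_const_mul, ← integral_const_mul]
  congr 1
  · refine integral_congr_ae (.of_forall fun z => ?_)
    simp only [incr, Pi.smul_apply, smul_eq_mul]; ring
  · refine integral_congr_ae (.of_forall fun ξ => ?_)
    simp only [Pi.smul_apply, smul_eq_mul]; ring

/-- A minimiser of the energy satisfies the variational inequality. -/
theorem weakForm_nonneg_of_minimizer (hp : 1 < p) (hμ : IsInteraction ν μ p Ω)
    (hφ : IsBoundedForcing φ M) (hu : u ∈ energyClass ν μ p Ω g h)
    (hmin : ∀ v ∈ energyClass ν μ p Ω g h, energy ν μ p Ω φ u ≤ energy ν μ p Ω φ v)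
    (hv : v ∈ energyClass ν μ p Ω g h) : 0 ≤ weakForm ν μ p Ω φ u (v - u) := by
  have hdI : MemLp (incr (v - u)) (ENNReal.ofReal p) μ := by
    rw [incr_sub]; exact hv.2.1.sub hu.2.1
  have hd : MemLp (v - u) (ENNReal.ofReal p) ν := hv.1.sub hu.1
  have hθ0 : ∀ k : ℕ, (0 : ℝ) < 1 / ((k : ℝ) + 1) := fun k => by positivity
  have hθ1 : ∀ k : ℕ, 1 / ((k : ℝ) + 1) ≤ 1 := fun k => by
    rw [div_le_one (by positivity)]; linarith [(Nat.cast_nonneg k : (0 : ℝ) ≤ k)]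
  have hθ : Filter.Tendsto (fun k : ℕ => 1 / ((k : ℝ) + 1)) Filter.atTop (nhds 0) :=
    tendsto_one_div_add_atTop_nhds_zero_nat
  set w : ℕ → X → ℝ := fun k => segPoint u v (1 / ((k : ℝ) + 1)) with hw
  have hwK : ∀ k, w k ∈ energyClass ν μ p Ω g h := fun k =>
    segPoint_mem hu hv (hθ0 k).le (hθ1 k)
  -- A Minty-type argument that avoids differentiating the energy: the subgradient inequality at `w
  -- k`, tested with `u`, has a nonpositive right side by minimality, and `u - w k` is a negative
  -- multiple of `v - u`. Letting `w k` tend to `u` concludes.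
  have hpos : ∀ k, 0 ≤ weakForm ν μ p Ω φ (w k) (v - u) := by
    intro k
    have h1 := weakForm_sub_le hp hμ hφ (hwK k) hu
    have h2 := hmin _ (hwK k)
    have h3 : weakForm ν μ p Ω φ (w k) (u - w k) =
        -(1 / ((k : ℝ) + 1)) * weakForm ν μ p Ω φ (w k) (v - u) := by
      rw [← weakForm_smul]
      congr 1
      ext ξ; simp [hw, segPoint]
    have h5 : -(1 / ((k : ℝ) + 1)) * weakForm ν μ p Ω φ (w k) (v - u) ≤ 0 := by
      rw [← h3]; linarith
    have h6 := hθ0 k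
    by_contra hneg
    push Not at hneg
    nlinarith
  have hlim : Filter.Tendsto (fun k => weakForm ν μ p Ω φ (w k) (v - u)) Filter.atTop
      (nhds (weakForm ν μ p Ω φ u (v - u))) := by
    refine Filter.Tendsto.sub ?_ ?_
    · refine tendsto_integral_of_dominated_convergence
        (fun z => 2 ^ p * (|incr u z| ^ p + |incr (v - u) z| ^ p) + |incr (v - u) z| ^ p)
        (fun k => (integrable_flux_incr_mul hp (hwK k).2.1 hdI).1)
        ((((integrable_abs_rpow hp hu.2.1).add (integrable_abs_rpow hp hdI)).const_mul _).add
          (integrable_abs_rpow hp hdI)) (fun k => .of_forall fun z => ?_) (.of_forall fun z => ?_)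
      · rw [Real.norm_eq_abs]
        refine (abs_flux_mul_le hp _ _).trans ?_
        gcongr
        have h1 : incr (w k) z = incr u z - (-(1 / ((k : ℝ) + 1)) * incr (v - u) z) := by
          rw [hw, incr_segPoint]; simp
        rw [h1]
        refine (abs_sub_rpow_le hp _ _).trans (mul_le_mul_of_nonneg_left
          (add_le_add_right (Real.rpow_le_rpow (abs_nonneg _) ?_ (by linarith)) _) (by positivity))
        rw [abs_mul, abs_neg, abs_of_pos (hθ0 k)]
        exact mul_le_of_le_one_left (abs_nonneg _) (hθ1 k)
      · refine Filter.Tendsto.mul_const _ (((continuous_flux hp).tendsto _).comp ?_)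
        have h1 : ∀ k, incr (w k) z = incr u z + 1 / ((k : ℝ) + 1) * incr (v - u) z := by
          intro k; rw [hw, incr_segPoint]; simp
        simp only [h1]
        simpa using (hθ.mul_const (incr (v - u) z)).const_add (incr u z)
    · refine tendsto_integral_of_dominated_convergence (fun ξ => M * |(v - u) ξ|)
        (fun k => (hφ.integrableOn_mul hμ hp (hwK k).1 hd).1)
        ((hμ.integrableOn hp hd).abs.const_mul M) (fun k => .of_forall fun ξ => ?_)
        (.of_forall fun ξ => ?_)
      · rw [Real.norm_eq_abs, abs_mul]
        gcongr
        exact hφ.abs_le ξ _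
      · refine Filter.Tendsto.mul_const _ (((hφ.continuous ξ).tendsto _).comp ?_)
        have h1 : ∀ k, w k ξ = u ξ + 1 / ((k : ℝ) + 1) * (v - u) ξ := by
          intro k; simp [hw, segPoint]
        simp only [h1]
        simpa using (hθ.mul_const ((v - u) ξ)).const_add (u ξ)
  exact ge_of_tendsto' hlim hpos

/-- Solutions of the variational inequality are unique. -/
theorem ae_eq_of_weakForm_nonneg (hp : 1 < p) (hμ : IsInteraction ν μ p Ω)
    (hφ : IsBoundedForcing φ M) (hu : u ∈ energyClass ν μ p Ω g h)
    (hv : v ∈ energyClass ν μ p Ω g h) (h1 : 0 ≤ weakForm ν μ p Ω φ u (v - u))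
    (h2 : 0 ≤ weakForm ν μ p Ω φ v (u - v)) : v =ᵐ[ν] u := by
  have hp0 : 0 < p := by linarith
  have hdI : MemLp (incr (v - u)) (ENNReal.ofReal p) μ := by
    rw [incr_sub]; exact hv.2.1.sub hu.2.1
  have hd : MemLp (v - u) (ENNReal.ofReal p) ν := hv.1.sub hu.1
  have hsym : weakForm ν μ p Ω φ v (u - v) = -weakForm ν μ p Ω φ v (v - u) := by
    rw [← neg_sub v u, ← neg_one_smul ℝ (v - u), weakForm_smul, neg_one_mul]
  rw [hsym] at h2
  have hFu := integrable_flux_incr_mul hp hu.2.1 hdI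
  have hFv := integrable_flux_incr_mul hp hv.2.1 hdI
  have hψu := hφ.integrableOn_mul hμ hp hu.1 hd
  have hψv := hφ.integrableOn_mul hμ hp hv.1 hd
  have h3 : ∫ ξ in Ω, φ ξ (v ξ) * (v - u) ξ ∂ν ≤ ∫ ξ in Ω, φ ξ (u ξ) * (v - u) ξ ∂ν := by
    refine integral_mono hψv hψu fun ξ => ?_
    simp only [Pi.sub_apply]
    rcases le_total (u ξ) (v ξ) with h | h
    · exact mul_le_mul_of_nonneg_right (hφ.antitone ξ h) (by linarith)
    · exact mul_le_mul_of_nonpos_right (hφ.antitone ξ h) (by linarith)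
  have hpt : ∀ z, 0 ≤ flux p (incr v z) * incr (v - u) z - flux p (incr u z) * incr (v - u) z := by
    intro z
    rw [← sub_mul, incr_sub, Pi.sub_apply]
    rcases eq_or_ne (incr v z) (incr u z) with h | h
    · simp [h]
    · exact (flux_sub_mul_pos hp h).le
  -- Adding the two variational inequalities bounds this integral by the difference of the forcing
  -- terms, which is nonpositive by `h3`.
  have h4 : ∫ z, (flux p (incr v z) * incr (v - u) z - flux p (incr u z) * incr (v - u) z) ∂μ =
      0 := by
    refine le_antisymm ?_ (integral_nonneg hpt)
    rw [integral_sub hFv hFu]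
    unfold weakForm at h1 h2
    linarith
  have h5 := (integral_eq_zero_iff_of_nonneg hpt (hFv.sub hFu)).1 h4
  have h6 : ∫ z, |incr (v - u) z| ^ p ∂μ = 0 := by
    refine integral_eq_zero_of_ae ?_
    filter_upwards [h5] with z hz
    simp only [Pi.zero_apply] at hz ⊢
    have : incr v z = incr u z := by
      by_contra hne
      have h7 := flux_sub_mul_pos hp hne
      rw [← sub_mul, incr_sub, Pi.sub_apply] at hz
      linarith
    rw [incr_sub, Pi.sub_apply, this, sub_self, abs_zero, Real.zero_rpow hp0.ne']
  obtain ⟨C, hC, hP⟩ := hμ.poincare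
  have h7 : ∫ ξ, |(v - u) ξ| ^ p ∂ν = 0 := by
    refine le_antisymm ?_ (integral_nonneg fun ξ => by positivity)
    have := hP _ hd hdI (sub_eq_zero_of_mem hu hv)
    rwa [h6, mul_zero] at this
  have h8 := (integral_eq_zero_iff_of_nonneg (fun ξ => by positivity)
    (integrable_abs_rpow hp hd)).1 h7
  filter_upwards [h8] with ξ hξ
  have := (Real.rpow_eq_zero (abs_nonneg _) hp0.ne').1 hξ
  simpa [sub_eq_zero] using this

end Solution

/-! ### Geometry of the Heisenberg group -/

section Geometry

variable {n : ℕ}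

theorem continuous_mul_inv : Continuous fun z : Heis n × Heis n => mul (inv z.2) z.1 := by
  unfold mul inv
  fun_prop

theorem inv_mul_inv (ξ η : Heis n) : inv (mul (inv η) ξ) = mul (inv ξ) η := by
  refine Prod.ext ?_ (Prod.ext ?_ ?_)
  · simp [mul, inv, add_comm]
  · simp [mul, inv, add_comm]
  · simp only [mul, inv, Pi.neg_apply, neg_mul, Finset.sum_neg_distrib, mul_comm (ξ.1 _),
      mul_comm (ξ.2.1 _)]
    ring

theorem mul_inv_cancel_left (ξ η : Heis n) : mul ξ (mul (inv ξ) η) = η := by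
  rw [← mul_assoc]
  have : mul ξ (inv ξ) = 0 := by
    refine Prod.ext ?_ (Prod.ext ?_ ?_)
    · simp [mul, inv]
    · simp [mul, inv]
    · simp [mul, inv, mul_comm]
  rw [this]
  refine Prod.ext ?_ (Prod.ext ?_ ?_) <;> simp [mul]

theorem mul_inv_eq_zero_iff (ξ η : Heis n) : mul (inv η) ξ = 0 ↔ ξ = η := by
  refine ⟨fun h => ?_, fun h => h ▸ inv_mul_self η⟩
  have h1 := mul_inv_cancel_left η ξ
  rw [h] at h1
  rw [← h1]
  refine Prod.ext ?_ (Prod.ext ?_ ?_) <;> simp [mul]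

theorem stdNorm_nonneg (ξ : Heis n) : 0 ≤ stdNorm ξ := by
  unfold stdNorm; positivity

theorem stdNorm_pow_four (ξ : Heis n) :
    stdNorm ξ ^ 4 = ((∑ i, ξ.1 i ^ 2) + ∑ i, ξ.2.1 i ^ 2) ^ 2 + ξ.2.2 ^ 2 := by
  unfold stdNorm
  rw [← Real.rpow_natCast, ← Real.rpow_mul (by positivity)]
  norm_num

theorem stdNorm_inv (ξ : Heis n) : stdNorm (inv ξ) = stdNorm ξ := by
  simp [stdNorm, inv]

theorem abs_le_stdNorm_sq (ξ : Heis n) : |ξ.2.2| ≤ stdNorm ξ ^ 2 := by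
  have h := stdNorm_pow_four ξ
  refine abs_le_of_sq_le_sq ?_ (by positivity)
  nlinarith [sq_nonneg ((∑ i, ξ.1 i ^ 2) + ∑ i, ξ.2.1 i ^ 2)]

theorem sum_sq_le_stdNorm_sq (ξ : Heis n) :
    (∑ i, ξ.1 i ^ 2) + ∑ i, ξ.2.1 i ^ 2 ≤ stdNorm ξ ^ 2 := by
  have h := stdNorm_pow_four ξ
  refine le_of_sq_le_sq ?_ (by positivity)
  nlinarith [sq_nonneg ξ.2.2]

theorem norm_fst_le_stdNorm (ξ : Heis n) : ‖ξ.1‖ ≤ stdNorm ξ := by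
  refine (pi_norm_le_iff_of_nonneg (stdNorm_nonneg ξ)).2 fun i => ?_
  refine abs_le_of_sq_le_sq ?_ (stdNorm_nonneg ξ)
  have h1 := Finset.single_le_sum (f := fun i => ξ.1 i ^ 2) (fun j _ => sq_nonneg _)
    (Finset.mem_univ i)
  have h2 : 0 ≤ ∑ i, ξ.2.1 i ^ 2 := Finset.sum_nonneg fun j _ => sq_nonneg _
  have := sum_sq_le_stdNorm_sq ξ
  linarith

theorem norm_snd_le_stdNorm (ξ : Heis n) : ‖ξ.2.1‖ ≤ stdNorm ξ := by
  refine (pi_norm_le_iff_of_nonneg (stdNorm_nonneg ξ)).2 fun i => ?_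
  refine abs_le_of_sq_le_sq ?_ (stdNorm_nonneg ξ)
  have h1 := Finset.single_le_sum (f := fun i => ξ.2.1 i ^ 2) (fun j _ => sq_nonneg _)
    (Finset.mem_univ i)
  have h2 : 0 ≤ ∑ i, ξ.1 i ^ 2 := Finset.sum_nonneg fun j _ => sq_nonneg _
  have := sum_sq_le_stdNorm_sq ξ
  linarith

/-- The last coordinate is only bounded by `stdNorm ξ ^ 2`, which forces the restriction to norm at
most `1`. -/
theorem norm_le_stdNorm {ξ : Heis n} (h : stdNorm ξ ≤ 1) : ‖ξ‖ ≤ stdNorm ξ := by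
  have h0 := stdNorm_nonneg ξ
  refine norm_prod_le_iff.2 ⟨norm_fst_le_stdNorm ξ, norm_prod_le_iff.2 ⟨norm_snd_le_stdNorm ξ, ?_⟩⟩
  refine (abs_le_stdNorm_sq ξ).trans ?_
  nlinarith

theorem isHomogeneousNorm_stdNorm : IsHomogeneousNorm (stdNorm : Heis n → ℝ) where
  continuous := by
    unfold stdNorm
    refine Continuous.rpow_const ?_ fun _ => Or.inr (by norm_num)
    fun_prop
  nonneg := stdNorm_nonneg
  map_dil r hr ξ := by
    have h1 : ∀ a b : ℝ, 0 ≤ a → 0 ≤ b → a ^ 4 = b ^ 4 → a = b := fun a b ha hb h =>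
      (pow_left_inj₀ ha hb (by norm_num)).1 h
    refine h1 _ _ (stdNorm_nonneg _) (mul_nonneg hr.le (stdNorm_nonneg _)) ?_
    rw [mul_pow, stdNorm_pow_four, stdNorm_pow_four]
    simp only [dil, Pi.smul_apply, smul_eq_mul, mul_pow, ← Finset.mul_sum]
    ring
  eq_zero_iff ξ := by
    constructor
    · intro h
      have := norm_le_stdNorm (ξ := ξ) (by rw [h]; norm_num)
      rw [h] at this
      exact norm_le_zero_iff.1 this
    · rintro rfl
      simp [stdNorm]

/-- Any two homogeneous norms are comparable. -/
theorem IsHomogeneousNorm.exists_le_mul_stdNorm {d : Heis n → ℝ} (hd : IsHomogeneousNorm d) :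
    ∃ C : ℝ, 0 < C ∧ ∀ ξ, d ξ ≤ C * stdNorm ξ ∧ stdNorm ξ ≤ C * d ξ := by
  have hN := isHomogeneousNorm_stdNorm (n := n)
  -- Bounds on this compact unit sphere spread to all nonzero points by dilation.
  set S : Set (Heis n) := {ξ | stdNorm ξ = 1} with hS
  have hSc : IsCompact S := by
    refine Metric.isCompact_of_isClosed_isBounded
      (isClosed_eq hN.continuous continuous_const) ?_
    refine (Metric.isBounded_closedBall (x := (0 : Heis n)) (r := 1)).subset fun ξ hξ => ?_
    have hξ : stdNorm ξ = 1 := hξ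
    have := norm_le_stdNorm hξ.le
    rw [hξ] at this
    simpa using this
  have hpos : ∀ ξ ∈ S, 0 < d ξ := by
    intro ξ hξ
    refine lt_of_le_of_ne (hd.nonneg ξ) fun h => ?_
    have h0 := (hd.eq_zero_iff ξ).1 h.symm
    have h1 : stdNorm ξ = 1 := hξ
    rw [(hN.eq_zero_iff ξ).2 h0] at h1
    exact zero_ne_one h1
  obtain ⟨A, hA⟩ := (hSc.image hd.continuous).bddAbove
  obtain ⟨a, ha, haS⟩ : ∃ a : ℝ, 0 < a ∧ ∀ ξ ∈ S, a ≤ d ξ := by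
    rcases S.eq_empty_or_nonempty with h | h
    · exact ⟨1, one_pos, by simp [h]⟩
    · obtain ⟨z, hz, hmin⟩ := hSc.exists_isMinOn h hd.continuous.continuousOn
      exact ⟨_, hpos z hz, fun w hw => hmin hw⟩
  refine ⟨max (max A a⁻¹) 1, by positivity, fun ξ => ?_⟩
  rcases eq_or_ne ξ 0 with rfl | hξ
  · rw [(hd.eq_zero_iff 0).2 rfl, (hN.eq_zero_iff 0).2 rfl]; simp
  have hr : 0 < stdNorm ξ := lt_of_le_of_ne (stdNorm_nonneg ξ)
    fun h => hξ ((hN.eq_zero_iff ξ).1 h.symm)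
  have hr' : 0 < (stdNorm ξ)⁻¹ := inv_pos.2 hr
  have hmem : dil (stdNorm ξ)⁻¹ ξ ∈ S := by
    change stdNorm _ = 1
    rw [hN.map_dil _ hr', inv_mul_cancel₀ hr.ne']
  have h1 : d (dil (stdNorm ξ)⁻¹ ξ) ≤ A := hA ⟨_, hmem, rfl⟩
  have h2 := haS _ hmem
  rw [hd.map_dil _ hr', inv_mul_eq_div] at h1 h2
  rw [div_le_iff₀ hr] at h1
  rw [le_div_iff₀ hr] at h2
  constructor
  · refine h1.trans ?_
    gcongr
    exact (le_max_left _ _).trans (le_max_left _ _)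
  · have h3 : stdNorm ξ ≤ a⁻¹ * d ξ := by
      rw [inv_mul_eq_div, le_div_iff₀ ha]; linarith
    refine h3.trans (mul_le_mul_of_nonneg_right ?_ (hd.nonneg ξ))
    exact (le_max_right _ _).trans (le_max_left _ _)

/-- The singular kernel `d(η⁻¹ ∘ ξ)^{-(Q + sp)}` at `z = (ξ, η)`. -/
def kernel (d : Heis n → ℝ) (s p : ℝ) (z : Heis n × Heis n) : ℝ :=
  (d (mul (inv z.2) z.1) ^ (homDim n + s * p))⁻¹

theorem IsHomogeneousNorm.kernel_nonneg {d : Heis n → ℝ} (hd : IsHomogeneousNorm d) (s p : ℝ)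
    (z : Heis n × Heis n) : 0 ≤ kernel d s p z :=
  inv_nonneg.2 (Real.rpow_nonneg (hd.nonneg _) _)

theorem IsHomogeneousNorm.measurable_kernel {d : Heis n → ℝ} (hd : IsHomogeneousNorm d)
    (s p : ℝ) : Measurable (kernel d s p) :=
  ((hd.continuous.comp continuous_mul_inv).measurable.pow_const _).inv

theorem kernel_le_mul_kernel {d₁ d₂ : Heis n → ℝ} (h₁ : IsHomogeneousNorm d₁)
    (h₂ : IsHomogeneousNorm d₂) {s p C : ℝ} (hq : 0 ≤ homDim n + s * p) (hC : 0 < C)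
    (h : ∀ ξ, d₂ ξ ≤ C * d₁ ξ) (z : Heis n × Heis n) :
    kernel d₁ s p z ≤ C ^ (homDim n + s * p) * kernel d₂ s p z := by
  unfold kernel
  set ζ := mul (inv z.2) z.1
  -- On the diagonal a positive exponent gives `0⁻¹ = 0` for both kernels.
  rcases eq_or_ne ζ 0 with hζ | hζ
  · rw [hζ, (h₁.eq_zero_iff 0).2 rfl, (h₂.eq_zero_iff 0).2 rfl]
    rcases hq.eq_or_lt with h0 | h0
    · simp [← h0]
    · simp [Real.zero_rpow h0.ne']
  have hpos : ∀ {d : Heis n → ℝ}, IsHomogeneousNorm d → 0 < d ζ := fun hd =>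
    lt_of_le_of_ne (hd.nonneg ζ) fun h => hζ ((hd.eq_zero_iff ζ).1 h.symm)
  have hp1 := hpos h₁
  have hp2 := hpos h₂
  rw [← div_eq_mul_inv, le_div_iff₀ (by positivity), inv_mul_eq_div, div_le_iff₀ (by positivity),
    ← Real.mul_rpow hC.le hp1.le]
  exact Real.rpow_le_rpow hp2.le (h ζ) hq

/-- Special to the standard norm: a general `d` need not satisfy `d (inv ξ) = d ξ`. -/
theorem kernel_stdNorm_swap (s p : ℝ) (z : Heis n × Heis n) :
    kernel stdNorm s p z.swap = kernel stdNorm s p z := by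
  unfold kernel
  rw [← inv_mul_inv, stdNorm_inv]
  rfl

/-- The standard kernel is integrable away from the origin. -/
theorem integrable_indicator_stdNorm_rpow {q δ : ℝ} (hq : homDim n < q) (hδ : 0 < δ) :
    Integrable ({ζ : Heis n | δ ≤ stdNorm ζ}.indicator fun ζ => (stdNorm ζ ^ q)⁻¹) := by
  -- The majorant is a product of powers of `1 + ‖x‖`, `1 + ‖y‖`, `1 + ‖t‖` with exponents `n + e`,
  -- `n + e`, `1 + e`. As `|t|` is bounded by the squared norm, the last counts twice: `2 * (n + e)
  -- + 2 * (1 + e) = q`.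
  set e := (q - homDim n) / 4 with he
  have he0 : 0 < e := by rw [he]; linarith
  have hN := isHomogeneousNorm_stdNorm (n := n)
  have hq0 : 0 < q := by
    have : 0 ≤ homDim n := by unfold homDim; positivity
    linarith
  have hI1 : Integrable fun x : Fin n → ℝ => (1 + ‖x‖) ^ (-((n : ℝ) + e)) :=
    integrable_one_add_norm (by simp [he0])
  have hI2 : Integrable fun t : ℝ => (1 + ‖t‖) ^ (-(1 + e)) :=
    integrable_one_add_norm (by simp [he0])
  have hI := hI1.mul_prod (hI1.mul_prod hI2)
  set A := δ⁻¹ + 1 with hA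
  have hA0 : 0 < A := by positivity
  refine (hI.const_mul (A ^ q)).mono' ?_ (.of_forall fun ζ => ?_)
  · refine AEStronglyMeasurable.indicator ?_ (isClosed_le continuous_const hN.continuous).measurableSet
    exact ((hN.continuous.measurable.pow_const _).inv).aestronglyMeasurable
  · rw [norm_indicator_eq_indicator_norm]
    refine Set.indicator_apply_le' (fun hζ => ?_) (fun _ => by positivity)
    have hζ : δ ≤ stdNorm ζ := hζ
    have hr : 0 < stdNorm ζ := hδ.trans_le hζ
    rw [Real.norm_of_nonneg (by positivity)]
    have h1 : (1 + stdNorm ζ) ^ q ≤ A ^ q * stdNorm ζ ^ q := by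
      rw [← Real.mul_rpow hA0.le hr.le]
      refine Real.rpow_le_rpow (by positivity) ?_ hq0.le
      have : 1 ≤ δ⁻¹ * stdNorm ζ := by
        rw [inv_mul_eq_div, le_div_iff₀ hδ]; linarith
      rw [hA]; linarith
    have h2 : (1 + ‖ζ.1‖) ^ ((n : ℝ) + e) * ((1 + ‖ζ.2.1‖) ^ ((n : ℝ) + e) *
        (1 + ‖ζ.2.2‖) ^ (1 + e)) ≤ (1 + stdNorm ζ) ^ q := by
      have h3 : (1 + stdNorm ζ) ^ q = (1 + stdNorm ζ) ^ ((n : ℝ) + e) *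
          ((1 + stdNorm ζ) ^ ((n : ℝ) + e) * ((1 + stdNorm ζ) ^ (2 : ℝ)) ^ (1 + e)) := by
        rw [← Real.rpow_mul (by positivity), ← Real.rpow_add (by positivity),
          ← Real.rpow_add (by positivity)]
        congr 1
        rw [he, homDim]; ring
      have h4 : 1 + ‖ζ.2.2‖ ≤ (1 + stdNorm ζ) ^ (2 : ℝ) := by
        rw [Real.rpow_two, Real.norm_eq_abs]
        nlinarith [abs_le_stdNorm_sq ζ]
      rw [h3]
      gcongr
      · exact norm_fst_le_stdNorm ζ
      · exact norm_snd_le_stdNorm ζ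
    rw [Real.rpow_neg (by positivity), Real.rpow_neg (by positivity), Real.rpow_neg (by positivity),
      ← mul_inv, ← mul_inv, ← div_eq_mul_inv, le_div_iff₀ (by positivity), inv_mul_eq_div,
      div_le_iff₀ (by positivity)]
    exact h2.trans h1

/-- The map is triangular: each coordinate is reflected and shifted by an amount depending only on
earlier ones, so it is an iterated skew product. -/
theorem measurePreserving_mul_inv (ξ : Heis n) :
    MeasurePreserving (fun η : Heis n => mul (inv η) ξ) := by
  let G : (Fin n → ℝ) → (Fin n → ℝ) × ℝ → (Fin n → ℝ) × ℝ := fun x w =>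
    (ξ.2.1 - w.1, (ξ.2.2 + 2 * (∑ i, (-w.1) i * ξ.1 i) - 2 * ∑ i, (-x) i * ξ.2.1 i) - w.2)
  have hG : ∀ x, MeasurePreserving (G x) := fun x =>
    MeasurePreserving.skew_product (f := fun y => ξ.2.1 - y)
      (g := fun y t => (ξ.2.2 + 2 * (∑ i, (-y) i * ξ.1 i) - 2 * ∑ i, (-x) i * ξ.2.1 i) - t)
      (Measure.measurePreserving_sub_left volume _)
      (Continuous.measurable (by unfold Function.uncurry; fun_prop))
      (.of_forall fun y => (Measure.measurePreserving_sub_left volume _).map_eq)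
  have h := MeasurePreserving.skew_product (f := fun x : Fin n → ℝ => ξ.1 - x) (g := G)
    (Measure.measurePreserving_sub_left volume _)
    (Continuous.measurable (by unfold Function.uncurry; fun_prop))
    (.of_forall fun x => (hG x).map_eq)
  have e : (fun η : Heis n => mul (inv η) ξ) = fun w => (ξ.1 - w.1, G w.1 w.2) := by
    ext η : 1
    refine Prod.ext ?_ (Prod.ext ?_ ?_)
    · simp [mul, inv]; abel
    · simp [mul, inv, G]; abel
    · simp [mul, inv, G]; ring
  rw [e]
  exact h

/-- The change of variables turning `|u ξ| ^ p * κ (η⁻¹ ∘ ξ)` into a product of functions of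
separate variables. -/
theorem measurePreserving_prod_mul_inv :
    MeasurePreserving (fun z : Heis n × Heis n => (z.1, mul (inv z.2) z.1)) :=
  MeasurePreserving.skew_product (f := id) (g := fun ξ η => mul (inv η) ξ)
    (MeasurePreserving.id _)
    ((continuous_mul_inv (n := n)).comp continuous_id).measurable
    (.of_forall fun ξ => (measurePreserving_mul_inv ξ).map_eq)

/-- Since `η = ξ ∘ (η⁻¹ ∘ ξ)⁻¹`, the tube lemma around `closure Ω × {0}` puts `η` in `Ω'` once `η⁻¹
∘ ξ` is small. No triangle inequality is needed. -/
theorem exists_le_stdNorm_of_notMem {Ω Ω' : Set (Heis n)} (hΩ' : IsOpen Ω')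
    (hΩb : Bornology.IsBounded Ω) (hsub : closure Ω ⊆ Ω') :
    ∃ δ : ℝ, 0 < δ ∧ ∀ ξ ∈ Ω, ∀ η ∉ Ω', δ ≤ stdNorm (mul (inv η) ξ) := by
  have hc : IsCompact (closure Ω) := hΩb.isCompact_closure
  have hcont : Continuous fun z : Heis n × Heis n => mul z.1 (inv z.2) := by
    unfold mul inv; fun_prop
  obtain ⟨U, V, -, hV, hU, h0, hUV⟩ := generalized_tube_lemma hc (isCompact_singleton (x := 0))
    (hΩ'.preimage hcont) (by
      rintro ⟨ξ, ζ⟩ ⟨hξ, hζ⟩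
      have hζ : ζ = 0 := hζ
      have : mul ξ (inv ζ) = ξ := by
        rw [hζ]; refine Prod.ext ?_ (Prod.ext ?_ ?_) <;> simp [mul, inv]
      change mul ξ (inv ζ) ∈ Ω'
      rw [this]
      exact hsub hξ)
  obtain ⟨r, hr, hball⟩ := Metric.isOpen_iff.1 hV 0 (h0 rfl)
  refine ⟨min r 1, by positivity, fun ξ hξ η hη => ?_⟩
  by_contra hlt
  push Not at hlt
  refine hη ?_
  have h1 : mul (inv η) ξ ∈ V := by
    refine hball ?_
    rw [mem_ball_zero_iff]
    exact (norm_le_stdNorm (hlt.le.trans (min_le_right _ _))).trans_lt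
      (hlt.trans_le (min_le_left _ _))
  have h2 : mul ξ (inv (mul (inv η) ξ)) ∈ Ω' :=
    hUV (Set.mk_mem_prod (hU (subset_closure hξ)) h1)
  rwa [inv_mul_inv, mul_inv_cancel_left] at h2

end Geometry

/-! ### Fractional Sobolev functions and the interaction measure -/

section Sobolev

variable {n : ℕ} {s p : ℝ} {d : Heis n → ℝ} {u v g : Heis n → ℝ} {Ω Ω' U : Set (Heis n)}

theorem aestronglyMeasurable_incr {X : Type*} [MeasurableSpace X] {ν : Measure X} [SFinite ν]
    {u : X → ℝ} (hu : AEStronglyMeasurable u ν) : AEStronglyMeasurable (incr u) (ν.prod ν) :=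
  (hu.comp_quasiMeasurePreserving Measure.quasiMeasurePreserving_fst).sub
    (hu.comp_quasiMeasurePreserving Measure.quasiMeasurePreserving_snd)

/-- The measure `d(η⁻¹ ∘ ξ)^{-(Q + sp)} dξ dη`. -/
def kernelMeasure (d : Heis n → ℝ) (s p : ℝ) : Measure (Heis n × Heis n) :=
  volume.withDensity fun z => ENNReal.ofReal (kernel d s p z)

theorem kernelMeasure_absolutelyContinuous (d : Heis n → ℝ) (s p : ℝ) :
    kernelMeasure d s p ≪ volume := withDensity_absolutelyContinuous _ _

theorem IsHomogeneousNorm.integrable_kernelMeasure_iff (hd : IsHomogeneousNorm d)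
    {F : Heis n × Heis n → ℝ} :
    Integrable F (kernelMeasure d s p) ↔ Integrable fun z => F z * kernel d s p z := by
  unfold kernelMeasure
  rw [integrable_withDensity_iff (hd.measurable_kernel s p).ennreal_ofReal
    (.of_forall fun z => ENNReal.ofReal_lt_top)]
  simp only [ENNReal.toReal_ofReal (hd.kernel_nonneg s p _)]

theorem IsHomogeneousNorm.integral_kernelMeasure (hd : IsHomogeneousNorm d)
    (F : Heis n × Heis n → ℝ) :
    ∫ z, F z ∂(kernelMeasure d s p) = ∫ z, F z * kernel d s p z := by
  unfold kernelMeasure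
  rw [integral_withDensity_eq_integral_toReal_smul (hd.measurable_kernel s p).ennreal_ofReal
    (.of_forall fun z => ENNReal.ofReal_lt_top)]
  simp only [ENNReal.toReal_ofReal (hd.kernel_nonneg s p _), smul_eq_mul, mul_comm]

theorem homDim_add_pos (hs : 0 < s) (hp : 1 < p) : homDim n < homDim n + s * p ∧
    0 < homDim n + s * p := by
  have h1 : 0 < s * p := mul_pos hs (by linarith)
  have h2 : 0 ≤ homDim n := by unfold homDim; positivity
  constructor <;> linarith

theorem aestronglyMeasurable_rpow_mul_kernel (hd : IsHomogeneousNorm d)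
    (hu : AEStronglyMeasurable u) :
    AEStronglyMeasurable fun z => |incr u z| ^ p * kernel d s p z :=
  (((aestronglyMeasurable_incr hu).aemeasurable.abs.pow_const p).mul
    (hd.measurable_kernel s p).aemeasurable).aestronglyMeasurable

/-- Finiteness of the Gagliardo energy does not depend on the homogeneous norm. -/
theorem memLp_incr_kernelMeasure_iff (hs : 0 < s) (hp : 1 < p) (hd : IsHomogeneousNorm d)
    (hu : AEStronglyMeasurable u) :
    MemLp (incr u) (ENNReal.ofReal p) (kernelMeasure d s p) ↔
      Integrable fun z => |incr u z| ^ p * kernel stdNorm s p z := by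
  rw [memLp_ofReal_iff hp ((aestronglyMeasurable_incr hu).mono_ac
    (kernelMeasure_absolutelyContinuous d s p)), hd.integrable_kernelMeasure_iff]
  have hN := isHomogeneousNorm_stdNorm (n := n)
  have hq := (homDim_add_pos (n := n) hs hp).2.le
  obtain ⟨C, hC, hCd⟩ := hd.exists_le_mul_stdNorm
  have key : ∀ {d₁ d₂ : Heis n → ℝ}, IsHomogeneousNorm d₁ → IsHomogeneousNorm d₂ →
      (∀ ξ, d₂ ξ ≤ C * d₁ ξ) → (Integrable fun z => |incr u z| ^ p * kernel d₂ s p z) →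
      Integrable fun z => |incr u z| ^ p * kernel d₁ s p z := by
    intro d₁ d₂ h₁ h₂ h hI
    refine (hI.const_mul (C ^ (homDim n + s * p))).mono'
      (aestronglyMeasurable_rpow_mul_kernel h₁ hu) (.of_forall fun z => ?_)
    rw [Real.norm_of_nonneg (mul_nonneg (by positivity) (h₁.kernel_nonneg s p z))]
    have := mul_le_mul_of_nonneg_left (kernel_le_mul_kernel h₁ h₂ hq hC h z)
      (show 0 ≤ |incr u z| ^ p by positivity)
    linarith
  exact ⟨key hN hd fun ξ => (hCd ξ).1, key hd hN fun ξ => (hCd ξ).2⟩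

/-- The `p`-th power of the quotient is the energy density, as `(Q / p + s) * p = Q + s * p`. -/
theorem memWsp_iff (hp : 1 < p) :
    MemWsp s p U u ↔ MemLp u (ENNReal.ofReal p) (volume.restrict U) ∧
      IntegrableOn (fun z => |incr u z| ^ p * kernel stdNorm s p z) (U ×ˢ U) := by
  have hp0 : 0 < p := by linarith
  unfold MemWsp
  refine and_congr_right fun hu => ?_
  have hN := isHomogeneousNorm_stdNorm (n := n)
  rw [memLp_ofReal_iff hp, Measure.prod_restrict]
  · refine integrable_congr (.of_forall fun z => ?_)
    have h0 := stdNorm_nonneg (mul (inv z.2) z.1)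
    simp only [kernel, incr]
    rw [abs_div, abs_abs, abs_of_nonneg (Real.rpow_nonneg h0 _),
      Real.div_rpow (abs_nonneg _) (Real.rpow_nonneg h0 _), ← Real.rpow_mul h0, div_eq_mul_inv]
    congr 4
    field_simp
  · exact ((aestronglyMeasurable_incr hu.1).aemeasurable.abs.div
      ((hN.continuous.comp continuous_mul_inv).measurable.pow_const _).aemeasurable)
      |>.aestronglyMeasurable

theorem integrableOn_incr_sub (hp : 1 < p) (hd : IsHomogeneousNorm d) {S : Set (Heis n × Heis n)}
    (hu : AEStronglyMeasurable u) (hv : AEStronglyMeasurable v)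
    (hIu : IntegrableOn (fun z => |incr u z| ^ p * kernel d s p z) S)
    (hIv : IntegrableOn (fun z => |incr v z| ^ p * kernel d s p z) S) :
    IntegrableOn (fun z => |incr (u - v) z| ^ p * kernel d s p z) S := by
  refine ((hIu.add hIv).const_mul (2 ^ p)).mono'
    (aestronglyMeasurable_rpow_mul_kernel hd (hu.sub hv)).restrict (.of_forall fun z => ?_)
  have hk := hd.kernel_nonneg s p z
  rw [Real.norm_of_nonneg (mul_nonneg (by positivity) hk)]
  have := mul_le_mul_of_nonneg_right (abs_sub_rpow_le hp (incr u z) (incr v z)) hk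
  rw [incr_sub]
  simp only [Pi.sub_apply, Pi.add_apply]
  linarith

/-- A function of `W^{s,p}(Ω')` that vanishes outside `Ω` has finite energy on the whole group. -/
theorem integrable_of_vanishing (hs : 0 < s) (hp : 1 < p) (hΩ' : IsOpen Ω')
    (hΩb : Bornology.IsBounded Ω) (hsub : closure Ω ⊆ Ω') (hΩ : MeasurableSet Ω)
    (hu : MemLp u (ENNReal.ofReal p)) (h0 : ∀ᵐ ξ ∂(volume.restrict Ωᶜ), u ξ = 0)
    (hI : IntegrableOn (fun z => |incr u z| ^ p * kernel stdNorm s p z) (Ω' ×ˢ Ω')) :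
    Integrable fun z => |incr u z| ^ p * kernel stdNorm s p z := by
  have hp0 : 0 < p := by linarith
  have hN := isHomogeneousNorm_stdNorm (n := n)
  obtain ⟨δ, hδ, hδΩ⟩ := exists_le_stdNorm_of_notMem hΩ' hΩb hsub
  set κ : Heis n → ℝ := {ζ : Heis n | δ ≤ stdNorm ζ}.indicator
    fun ζ => (stdNorm ζ ^ (homDim n + s * p))⁻¹ with hκ
  have hκI : Integrable κ :=
    integrable_indicator_stdNorm_rpow (homDim_add_pos hs hp).1 hδ
  have hκ0 : ∀ ζ, 0 ≤ κ ζ := fun ζ => Set.indicator_nonneg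
    (fun ζ _ => inv_nonneg.2 (Real.rpow_nonneg (stdNorm_nonneg ζ) _)) ζ
  have hκmem : ∀ ζ, δ ≤ stdNorm ζ → κ ζ = (stdNorm ζ ^ (homDim n + s * p))⁻¹ := fun ζ hζ =>
    Set.indicator_of_mem (s := {ζ : Heis n | δ ≤ stdNorm ζ}) hζ _
  have hT1 : Integrable fun z : Heis n × Heis n => |u z.1| ^ p * κ (mul (inv z.2) z.1) :=
    measurePreserving_prod_mul_inv.integrable_comp_of_integrable
      ((integrable_abs_rpow hp hu).mul_prod hκI)
  have hT2 : Integrable fun z : Heis n × Heis n => |u z.2| ^ p * κ (mul (inv z.1) z.2) :=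
    hT1.swap
  have hI' := (integrable_indicator_iff (hΩ'.measurableSet.prod hΩ'.measurableSet)).2 hI
  -- Pairs in `Ω' ×ˢ Ω'` are covered by the first term. For other pairs the increment vanishes
  -- unless one point lies in `Ω` and the other off `Ω'`; these are at distance at least `δ`, where
  -- the truncated kernel `κ` is the kernel.
  refine ((hI'.add hT1).add hT2).mono' (aestronglyMeasurable_rpow_mul_kernel hN hu.1) ?_
  have h0' : ∀ᵐ ξ : Heis n, ξ ∉ Ω → u ξ = 0 := (ae_restrict_iff' hΩ.compl).1 h0
  have hΩΩ' : Ω ⊆ Ω' := subset_closure.trans hsub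
  filter_upwards [Measure.quasiMeasurePreserving_fst.ae h0',
    Measure.quasiMeasurePreserving_snd.ae h0'] with z hz1 hz2
  have hk := hN.kernel_nonneg s p z
  rw [Real.norm_of_nonneg (mul_nonneg (by positivity) hk)]
  simp only [Pi.add_apply]
  have hn0 : 0 ≤ (Ω' ×ˢ Ω').indicator (fun z => |incr u z| ^ p * kernel stdNorm s p z) z :=
    Set.indicator_nonneg (fun z _ => mul_nonneg (by positivity) (hN.kernel_nonneg s p z)) z
  have hn1 : 0 ≤ |u z.1| ^ p * κ (mul (inv z.2) z.1) := mul_nonneg (by positivity) (hκ0 _)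
  have hn2 : 0 ≤ |u z.2| ^ p * κ (mul (inv z.1) z.2) := mul_nonneg (by positivity) (hκ0 _)
  by_cases h1 : z.1 ∈ Ω'
  · by_cases h2 : z.2 ∈ Ω'
    · rw [Set.indicator_of_mem (Set.mk_mem_prod h1 h2)]
      linarith
    · have hu2 := hz2 fun h => h2 (hΩΩ' h)
      by_cases h3 : z.1 ∈ Ω
      · have h4 : κ (mul (inv z.2) z.1) = kernel stdNorm s p z :=
          hκmem _ (hδΩ _ h3 _ h2)
        have h5 : incr u z = u z.1 := by simp [incr, hu2]
        rw [h4, h5]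
        linarith
      · have hu1 := hz1 h3
        have : |incr u z| ^ p = 0 := by simp [incr, hu1, hu2, Real.zero_rpow hp0.ne']
        rw [this, zero_mul]
        linarith
  · have hu1 := hz1 fun h => h1 (hΩΩ' h)
    by_cases h3 : z.2 ∈ Ω
    · have h4 : κ (mul (inv z.1) z.2) = kernel stdNorm s p z := by
        rw [← kernel_stdNorm_swap]
        exact hκmem _ (hδΩ _ h3 _ h1)
      have h5 : |incr u z| = |u z.2| := by simp [incr, hu1]
      rw [h4, h5]
      linarith
    · have hu2 := hz2 h3
      have : |incr u z| ^ p = 0 := by simp [incr, hu1, hu2, Real.zero_rpow hp0.ne']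
      rw [this, zero_mul]
      linarith

/-- The admissible class consists of functions of finite energy on the whole group. -/
theorem obstacleClass_eq_energyClass (hs : 0 < s) (hp : 1 < p) (hd : IsHomogeneousNorm d)
    (hΩ : IsOpen Ω) (hΩ' : IsOpen Ω') (hΩb : Bornology.IsBounded Ω) (hsub : closure Ω ⊆ Ω')
    (hg : MemWsp s p Set.univ g) (h : Heis n → EReal) :
    obstacleClass s p g h Ω Ω' = energyClass volume (kernelMeasure d s p) p Ω g h := by
  have hN := isHomogeneousNorm_stdNorm (n := n)
  rw [memWsp_iff hp, Measure.restrict_univ, Set.univ_prod_univ, integrableOn_univ] at hg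
  ext u
  constructor
  · rintro ⟨hu, hh, hb⟩
    rw [memWsp_iff hp] at hu
    have hb' : ∀ᵐ ξ ∂(volume.restrict Ωᶜ), (u - g) ξ = 0 := by
      filter_upwards [hb] with ξ hξ
      simp [hξ]
    -- Membership controls `u` only on `Ω'`; elsewhere measurability and integrability come from `u
    -- = g` on `Ωᶜ`.
    have hcover : Ω' ∪ Ωᶜ = Set.univ :=
      Set.eq_univ_of_forall fun ξ => (em (ξ ∈ Ω)).imp (fun hξ => hsub (subset_closure hξ)) id
    have hwm : AEStronglyMeasurable (u - g) (volume.restrict (Ω' ∪ Ωᶜ)) := by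
      rw [aestronglyMeasurable_union_iff]
      exact ⟨hu.1.1.sub hg.1.1.restrict,
        (aestronglyMeasurable_const (b := (0 : ℝ))).congr (hb'.mono fun ξ hξ => hξ.symm)⟩
    rw [hcover, Measure.restrict_univ] at hwm
    have hum : AEStronglyMeasurable u volume := by simpa using hwm.add hg.1.1
    have hw : MemLp (u - g) (ENNReal.ofReal p) := by
      rw [memLp_ofReal_iff hp hwm, ← integrableOn_univ, ← hcover, integrableOn_union]
      refine ⟨integrable_abs_rpow hp (hu.1.sub (hg.1.restrict _)), ?_⟩
      refine (integrable_zero _ ℝ _).congr ?_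
      filter_upwards [hb'] with ξ hξ
      rw [hξ, abs_zero, Real.zero_rpow (by linarith)]
      rfl
    have hwI := integrable_of_vanishing hs hp hΩ' hΩb hsub hΩ.measurableSet hw hb'
      (integrableOn_incr_sub hp hN hum hg.1.1 hu.2 hg.2.integrableOn)
    have hwL := (memLp_incr_kernelMeasure_iff hs hp hd hwm).2 hwI
    have hgL := (memLp_incr_kernelMeasure_iff hs hp hd hg.1.1).2 hg.2
    refine ⟨by simpa using hw.add hg.1, ?_, hh, hb⟩
    rw [incr_sub] at hwL
    simpa using hwL.add hgL
  · rintro ⟨hu, hI, hh, hb⟩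
    refine ⟨(memWsp_iff hp).2 ⟨hu.restrict _, ?_⟩, hh, hb⟩
    exact ((memLp_incr_kernelMeasure_iff hs hp hd hu.1).1 hI).integrableOn

/-- The interaction measure of the fractional `p`-Laplacian satisfies a Poincaré inequality. -/
theorem isInteraction_kernelMeasure (hs : 0 < s) (hp : 1 < p) (hd : IsHomogeneousNorm d)
    (hΩ : MeasurableSet Ω) (hΩb : Bornology.IsBounded Ω) :
    IsInteraction volume (kernelMeasure d s p) p Ω where
  absolutelyContinuous := kernelMeasure_absolutelyContinuous d s p
  measure_lt_top := hΩb.measure_lt_top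
  poincare := by
    have hp0 : 0 < p := by linarith
    have hq := (homDim_add_pos (n := n) hs hp).2
    obtain ⟨R, hR⟩ := hΩb.subset_closedBall (0 : Heis n)
    -- Points of the unit ball around `c` have last coordinate above `R + 1`, hence lie off `Ω`. On
    -- `Ω ×ˢ B` the increment of `w` is `w ξ`, and the kernel is bounded below because `d` is
    -- bounded there; integrating out `η` yields the inequality.
    set c : Heis n := (0, 0, R + 2) with hc
    set B := Metric.ball c 1 with hB
    have hBΩ : ∀ η ∈ B, η ∉ Ω := by
      intro η hη hηΩ
      have h1 := mem_closedBall_zero_iff.1 (hR hηΩ)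
      have h2 : ‖η.2.2‖ ≤ R := (norm_snd_le η.2).trans ((norm_snd_le η).trans h1)
      have h3 : ‖(η - c).2.2‖ < 1 :=
        ((norm_snd_le _).trans (norm_snd_le _)).trans_lt (mem_ball_iff_norm.1 hη)
      have h4 : (η - c).2.2 = η.2.2 - (R + 2) := rfl
      rw [h4, Real.norm_eq_abs] at h3
      have h5 := (abs_lt.1 h3).1
      have h6 := le_abs_self η.2.2
      rw [Real.norm_eq_abs] at h2
      linarith
    obtain ⟨D, hD⟩ := (((isCompact_closedBall (0 : Heis n) R).prod
      (isCompact_closedBall c 1)).image (hd.continuous.comp continuous_mul_inv)).bddAbove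
    have hDz : ∀ z ∈ Ω ×ˢ B, d (mul (inv z.2) z.1) ≤ max D 1 := fun z hz =>
      (hD ⟨z, ⟨hR hz.1, Metric.ball_subset_closedBall hz.2⟩, rfl⟩).trans (le_max_left _ _)
    set D' := max D 1
    have hD' : 0 < D' := by positivity
    have hBpos : 0 < (volume.restrict B).real Set.univ := by
      rw [measureReal_restrict_apply_univ]
      exact ENNReal.toReal_pos (Metric.measure_ball_pos volume c one_pos).ne'
        Metric.isBounded_ball.measure_lt_top.ne
    have : IsFiniteMeasure (volume.restrict B) :=
      ⟨by simpa using Metric.isBounded_ball.measure_lt_top⟩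
    set b := (volume.restrict B).real Set.univ
    refine ⟨b⁻¹ * D' ^ (homDim n + s * p), by positivity, fun w hw hwI hw0 => ?_⟩
    have hI := hd.integrable_kernelMeasure_iff.1 (integrable_abs_rpow hp hwI)
    have hw0' : ∀ᵐ ξ : Heis n, ξ ∉ Ω → w ξ = 0 := (ae_restrict_iff' hΩ.compl).1 hw0
    have h1 : ∫ ξ, |w ξ| ^ p = ∫ ξ in Ω, |w ξ| ^ p := by
      refine (setIntegral_eq_integral_of_ae_compl_eq_zero ?_).symm
      filter_upwards [hw0'] with ξ hξ hξΩ
      rw [hξ hξΩ, abs_zero, Real.zero_rpow hp0.ne']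
    have h2 : ∫ z in Ω ×ˢ B, |w z.1| ^ p = (∫ ξ in Ω, |w ξ| ^ p) * b := by
      have := integral_prod_mul (μ := volume.restrict Ω) (ν := volume.restrict B)
        (fun ξ => |w ξ| ^ p) (fun _ => (1 : ℝ))
      simp only [Measure.prod_restrict, integral_const, smul_eq_mul, mul_one] at this
      exact this
    have hI1 : IntegrableOn (fun z : Heis n × Heis n => |w z.1| ^ p) (Ω ×ˢ B) := by
      have := (integrable_abs_rpow hp hw).integrableOn (s := Ω) |>.mul_prod
        (integrable_const (1 : ℝ) (μ := volume.restrict B))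
      simp only [Measure.prod_restrict, mul_one] at this
      exact this
    have h3 : ∫ z in Ω ×ˢ B, |w z.1| ^ p ≤
        D' ^ (homDim n + s * p) * ∫ z in Ω ×ˢ B, |incr w z| ^ p * kernel d s p z := by
      rw [← integral_const_mul]
      refine integral_mono_ae hI1 (hI.integrableOn.const_mul _) ?_
      filter_upwards [ae_restrict_mem (hΩ.prod Metric.isOpen_ball.measurableSet),
        ae_restrict_of_ae (Measure.quasiMeasurePreserving_snd.ae hw0')] with z hz hz0
      have hw2 : w z.2 = 0 := hz0 (hBΩ _ hz.2)
      -- Needed because `kernel` takes the value `0` on the diagonal, where the lower bound fails.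
      have hne : mul (inv z.2) z.1 ≠ 0 := fun h =>
        hBΩ _ hz.2 ((mul_inv_eq_zero_iff _ _).1 h ▸ hz.1)
      have hdpos : 0 < d (mul (inv z.2) z.1) :=
        lt_of_le_of_ne (hd.nonneg _) fun h => hne ((hd.eq_zero_iff _).1 h.symm)
      have hk : 1 ≤ D' ^ (homDim n + s * p) * kernel d s p z := by
        rw [kernel, ← div_eq_mul_inv, one_le_div (by positivity)]
        exact Real.rpow_le_rpow hdpos.le (hDz z hz) hq.le
      have hwp : 0 ≤ |w z.1| ^ p := by positivity
      simp only [incr, hw2, sub_zero]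
      nlinarith
    have h4 : ∫ z in Ω ×ˢ B, |incr w z| ^ p * kernel d s p z ≤
        ∫ z, |incr w z| ^ p ∂(kernelMeasure d s p) := by
      rw [hd.integral_kernelMeasure]
      exact setIntegral_le_integral hI
        (.of_forall fun z => mul_nonneg (by positivity) (hd.kernel_nonneg s p z))
    rw [h1, _root_.mul_assoc, inv_mul_eq_div, le_div_iff₀ hBpos, ← h2]
    exact h3.trans (mul_le_mul_of_nonneg_left h4 (by positivity))

end Sobolev

/-! ### Regularisation of the nonlinearity on a null set -/

section Forcing

variable {n : ℕ} {f : Heis n → ℝ → ℝ} {Ω : Set (Heis n)}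

/-- The exceptional null sets in the bound and the monotonicity depend on the real arguments.
Restricting these to rationals leaves a single null set, and continuity in `x` recovers all reals.
Off the good part of `Ω` the nonlinearity is set to `0`, as the uniform bound holds on `Ω` only. -/
theorem exists_isBoundedForcing (hΩ : MeasurableSet Ω) (hf_car : IsCaratheodory f)
    (hf_bdd : IsLocBoundedUnif f Ω) (hf_mono : IsNonincreasing f) :
    ∃ (φ : Heis n → ℝ → ℝ) (M : ℝ), 0 ≤ M ∧ IsBoundedForcing φ M ∧
      ∀ᵐ ξ ∂(volume.restrict Ω), ∀ x, φ ξ x = f ξ x := by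
  obtain ⟨M, hM⟩ := hf_bdd.2
  have hM' : ∀ᵐ ξ : Heis n, ∀ q : ℚ, ξ ∈ Ω → |f ξ q| ≤ M :=
    ae_all_iff.2 fun q => (ae_restrict_iff' hΩ).1 (hM q)
  have hmk : ∀ᵐ ξ : Heis n, ∀ q : ℚ, f ξ q = (hf_car.1 q).mk _ ξ :=
    ae_all_iff.2 fun q => (hf_car.1 q).ae_eq_mk
  have hmono : ∀ᵐ ξ : Heis n, ∀ q₁ q₂ : ℚ, (f ξ q₁ - f ξ q₂) * ((q₁ : ℝ) - q₂) ≤ 0 :=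
    ae_all_iff.2 fun q₁ => ae_all_iff.2 fun q₂ => hf_mono q₁ q₂
  obtain ⟨G, hG, hGm, hGae⟩ : ∃ G : Set (Heis n), (∀ ξ ∈ G, Continuous (f ξ) ∧
      (∀ q : ℚ, ξ ∈ Ω → |f ξ q| ≤ M) ∧ (∀ q : ℚ, f ξ q = (hf_car.1 q).mk _ ξ) ∧
      ∀ q₁ q₂ : ℚ, (f ξ q₁ - f ξ q₂) * ((q₁ : ℝ) - q₂) ≤ 0) ∧ MeasurableSet G ∧
      ∀ᵐ ξ : Heis n, ξ ∈ G := by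
    have hall := hf_car.2.and (hM'.and (hmk.and hmono))
    obtain ⟨T, hT, hTm, hT0⟩ := exists_measurable_superset_of_null (ae_iff.1 hall)
    refine ⟨Tᶜ, fun ξ hξ => ?_, hTm.compl, measure_eq_zero_iff_ae_notMem.1 hT0⟩
    by_contra hcon
    exact hξ (hT hcon)
  classical
  set S := G ∩ Ω with hS
  have hSm : MeasurableSet S := hGm.inter hΩ
  set φ : Heis n → ℝ → ℝ := fun ξ x => if ξ ∈ S then f ξ x else 0 with hφ
  have hcont : ∀ ξ, Continuous (φ ξ) := by
    intro ξ
    by_cases h : ξ ∈ S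
    · simpa only [hφ, if_pos h] using (hG ξ h.1).1
    · simpa only [hφ, if_neg h] using continuous_const
  have hrat : ∀ q : ℚ, Measurable fun ξ => φ ξ q := by
    intro q
    have : (fun ξ => φ ξ q) = fun ξ => if ξ ∈ S then (hf_car.1 q).mk _ ξ else 0 := by
      ext ξ
      by_cases h : ξ ∈ S
      · simp only [hφ, if_pos h, (hG ξ h.1).2.2.1 q]
      · simp only [hφ, if_neg h]
    rw [this]
    exact Measurable.ite hSm (hf_car.1 q).measurable_mk measurable_const
  have hmeas : ∀ x : ℝ, Measurable fun ξ => φ ξ x := by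
    intro x
    obtain ⟨a, ha, hlim⟩ := mem_closure_iff_seq_limit.1 (Rat.denseRange_cast (𝕜 := ℝ) x)
    choose q hq using ha
    refine measurable_of_tendsto_metrizable (fun k => hrat (q k)) (tendsto_pi_nhds.2 fun ξ => ?_)
    simp only [hq]
    exact ((hcont ξ).tendsto x).comp hlim
  refine ⟨φ, max M 0, le_max_right _ _, ⟨?_, hcont, ?_, ?_⟩, ?_⟩
  · have := measurable_uncurry_of_continuous_of_measurable (u := fun (x : ℝ) ξ => φ ξ x)
      hcont hmeas
    exact this.comp measurable_swap
  · intro ξ x y hxy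
    by_cases h : ξ ∈ S
    · simp only [hφ, if_pos h]
      obtain ⟨hc, -, -, hm⟩ := hG ξ h.1
      have key : (f ξ y - f ξ x) * (y - x) ≤ 0 := by
        refine DenseRange.induction_on₂ (p := fun y x : ℝ => (f ξ y - f ξ x) * (y - x) ≤ 0)
          (Rat.denseRange_cast (𝕜 := ℝ)) (isClosed_le ?_ continuous_const) hm y x
        fun_prop
      rcases hxy.eq_or_lt with rfl | hlt
      · exact le_rfl
      · by_contra hcon
        push Not at hcon
        have := mul_pos (sub_pos.2 hcon) (sub_pos.2 hlt)
        linarith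
    · simp only [hφ, if_neg h, le_refl]
  · intro ξ x
    by_cases h : ξ ∈ S
    · simp only [hφ, if_pos h]
      obtain ⟨hc, hb, -, -⟩ := hG ξ h.1
      refine le_trans ?_ (le_max_left _ _)
      exact DenseRange.induction_on (p := fun x : ℝ => |f ξ x| ≤ M)
        (Rat.denseRange_cast (𝕜 := ℝ)) x (isClosed_le hc.abs continuous_const)
        fun q => hb q h.2
    · simp only [hφ, if_neg h, abs_zero, le_max_right]
  · filter_upwards [ae_restrict_mem hΩ, ae_restrict_of_ae hGae] with ξ h1 h2 x
    simp only [hφ, hS, if_pos (Set.mem_inter h2 h1)]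

end Forcing

end Heis

end

theorem theorem1 {n : ℕ} {s p : ℝ} (hs : s ∈ Set.Ioo (0 : ℝ) 1) (hp : 1 < p)
    {d : Heis n → ℝ} (hd : Heis.IsHomogeneousNorm d)
    {Ω Ω' : Set (Heis n)} (hΩ : IsOpen Ω) (hΩ' : IsOpen Ω')
    (hΩ'b : Bornology.IsBounded Ω') (hsub : closure Ω ⊆ Ω')
    {f : Heis n → ℝ → ℝ} (hf_car : Heis.IsCaratheodory f)
    (hf_bdd : Heis.IsLocBoundedUnif f Ω) (hf_mono : Heis.IsNonincreasing f)
    {g : Heis n → ℝ} (hg : Heis.MemWsp s p Set.univ g)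
    {h : Heis n → EReal} (hh : ∀ ξ, h ξ < ⊤)
    (hne : (Heis.obstacleClass s p g h Ω Ω').Nonempty) :
    -- the integrals in `⟨A(u), v - u⟩` converge absolutely for all admissible `u`, `v`
    (∀ u ∈ Heis.obstacleClass s p g h Ω Ω', ∀ v ∈ Heis.obstacleClass s p g h Ω Ω',
      MeasureTheory.Integrable (Heis.formIntegrand d s p u (v - u)) ∧
      MeasureTheory.IntegrableOn (fun ξ => f ξ (u ξ) * (v - u) ξ) Ω) ∧
    -- there is a solution, and it is unique up to equality almost everywhere
    ∃ u, Heis.IsObstacleSolution d s p f g h Ω Ω' u ∧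
      ∀ w, Heis.IsObstacleSolution d s p f g h Ω Ω' w → w =ᵐ[MeasureTheory.volume] u := by
  have hΩb : Bornology.IsBounded Ω := hΩ'b.subset (subset_closure.trans hsub)
  obtain ⟨φ, M, hM, hφ, hφf⟩ :=
    Heis.exists_isBoundedForcing hΩ.measurableSet hf_car hf_bdd hf_mono
  have hK := Heis.obstacleClass_eq_energyClass hs.1 hp hd hΩ hΩ' hΩb hsub hg h
  have hμ := Heis.isInteraction_kernelMeasure hs.1 hp hd hΩ.measurableSet hΩb
  have hform : ∀ u v : Heis n → ℝ, Heis.formIntegrand d s p u v = fun z =>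
      Heis.flux p (Heis.incr u z) * Heis.incr v z * Heis.kernel d s p z := fun u v => by
    ext z
    rw [Heis.formIntegrand, div_eq_mul_inv]
    rfl
  have hlow : ∀ u v : Heis n → ℝ, (fun ξ => φ ξ (u ξ) * v ξ) =ᵐ[MeasureTheory.volume.restrict Ω]
      fun ξ => f ξ (u ξ) * v ξ := fun u v => by
    filter_upwards [hφf] with ξ hξ
    rw [hξ]
  have hpair : ∀ u v : Heis n → ℝ, Heis.pairing d s p f Ω u v =
      Heis.weakForm MeasureTheory.volume (Heis.kernelMeasure d s p) p Ω φ u v := fun u v => by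
    rw [Heis.pairing, Heis.weakForm, hform, hd.integral_kernelMeasure,
      MeasureTheory.integral_congr_ae (hlow u v)]
  unfold Heis.IsObstacleSolution
  rw [hK] at hne ⊢
  refine ⟨fun u hu v hv => ⟨?_, ?_⟩, ?_⟩
  · rw [hform]
    refine hd.integrable_kernelMeasure_iff.1 (Heis.integrable_flux_incr_mul hp hu.2.1 ?_)
    rw [Heis.incr_sub]
    exact hv.2.1.sub hu.2.1
  · exact (hφ.integrableOn_mul hμ hp hu.1 (hv.1.sub hu.1)).congr (hlow u (v - u))
  · obtain ⟨u, hu, hmin⟩ := Heis.exists_energy_minimizer hp hμ hφ hM hne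
    have hsol : ∀ v ∈ Heis.energyClass MeasureTheory.volume (Heis.kernelMeasure d s p) p Ω g h,
        0 ≤ Heis.weakForm MeasureTheory.volume (Heis.kernelMeasure d s p) p Ω φ u (v - u) :=
      fun v hv => Heis.weakForm_nonneg_of_minimizer hp hμ hφ hu hmin hv
    refine ⟨u, ⟨hu, fun v hv => (hpair u _).symm ▸ hsol v hv⟩, fun w hw => ?_⟩
    exact Heis.ae_eq_of_weakForm_nonneg hp hμ hφ hu hw.1 (hsol w hw.1) (hpair w _ ▸ hw.2 u hu)
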